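/- \textbf{Theorem.} Let $\mathbf P\subset\mathbb N^2$ be a pier fractal and let $c\in\mathbb Z^+$. Then the $c$-scaling $\mathbf P^c=\{(x,y)\in\mathbb Z^2 : (\lfloor x/c\rfloor,\lfloor y/c\rfloor)\in\mathbf P\}$ does not strictly self-assemble in the abstract Tile Assembly Model: there is no tile assembly system $\mathcal T=(T,\sigma,\tau)$ (at any temperature $\tau\in\mathbb Z^+$) that strictly self-assembles $\mathbf P^c$. \textbf{Pier fractals.} $\mathbf P$ is a pier fractal if for some integer $g>1$ and some set $G$ with $\{(0,0)\}\subsetneq G\subsetneq\{0,\dots,g-1\}^2$ that has at least one point in each of the $g$ rows and in each of the $g$ columns, $\mathbf P=\bigcup_{i\ge1}X_i$, where $X_1=G$ and $X_{i+1}=\{\vec m+g^i\vec n : \vec m\in X_i,\ \vec n\in G\}$, and moreover (a) the graph on $G$ in which points at distance $1$ are adjacent is connected; (b) $G$ has exactly one h-bridge and exactly one v-bridge, where an h-bridge (v-bridge) is a subset of $G$ consisting of the point of the leftmost column and the point of the rightmost column in a common row (the point of the bottom row and the point of the top row in a common column); (c) $G$ contains a pier, i.e. a point such that exactly three of its four neighbours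 in $\mathbb Z^2$ are not in $G$. \textbf{The model.} A tile type assigns to each of the four sides of a unit square a glue, i.e. a pair of a finite string over a fixed alphabet and a strength in $\mathbb N$. For a finite set $T$ of tile types, a configuration is a partial function $\alpha:\mathbb Z^2\dashrightarrow T$; it is an assembly if $\operatorname{dom}\alpha$ is non-empty and connected in the grid graph. Adjacent tiles bind, with the strength of the common glue, if their abutting glues are equal and have positive strength. $\alpha$ is $\tau$-stable if every cut-set of the resulting weighted graph on $\operatorname{dom}\alpha$ has total strength at least $\tau$. A tile assembly system consists of a finite tile set $T$, a finite $\tau$-stable seed assembly $\sigma$, and $\tau\in\mathbb Z^+$. One step goes from a $\tau$-stable assembly to a $\tau$-stable assembly that extends it by exactly one tile. An assembly is producible if it is the result (the union of all terms) of a finite or infinite sequence of steps starting at $\sigma$; a $\tau$-stable assembly is terminal if no step leads from it. $\mathcal T$ strictly self-assembles $X\subseteq\mathbb Z^2$ if $\operatorname{dom}\alpha=X$ for every producible terminal assembly $\alpha$. -/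

import Mathlib

open scoped ENNReal

/-- The four directions. -/
inductive Dir : Type
  | N | E | S | W

namespace Dir

/-- A direction as a function from the integer plane to itself. -/
def move : Dir → ℤ × ℤ → ℤ × ℤ
  | N, p => (p.1, p.2 + 1)
  | E, p => (p.1 + 1, p.2)
  | S, p => (p.1, p.2 - 1)
  | W, p => (p.1 - 1, p.2)

/-- The opposite (inverse) direction. -/
def opp : Dir → Dir
  | N => S
  | E => W
  | S => N
  | W => E

theorem move_opp (d : Dir) (p : ℤ × ℤ) : d.opp.move (d.move p) = p := by
  cases d <;> simp [move, opp]

end Dir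

/-- The full grid graph of the integer plane: two points are adjacent iff they are
at distance one, that is, iff one is obtained from the other by one of the four directions. -/
def gridGraph : SimpleGraph (ℤ × ℤ) where
  Adj x y := ∃ d : Dir, d.move x = y
  symm := ⟨by
    rintro x y ⟨d, rfl⟩
    exact ⟨d.opp, d.move_opp x⟩⟩
  loopless := ⟨by
    rintro x ⟨d, h⟩
    cases d <;> simp [Dir.move, Prod.ext_iff] at h⟩

/-- The full grid graph of a set of points. -/
def fullGridGraph (V : Set (ℤ × ℤ)) : SimpleGraph V := gridGraph.induce V

/-! ### The abstract Tile Assembly Model -/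

/-- A glue: a finite string over the alphabet `Sym`, and a strength. -/
structure Glue (Sym : Type*) where
  label : List Sym
  strength : ℕ

/-- A tile type: a glue on each of the four sides. -/
abbrev TileType (Sym : Type*) := Dir → Glue Sym

/-- A configuration of tiles from `T`: a partial function from the plane to `T`. -/
abbrev Config {Sym : Type*} (T : Finset (TileType Sym)) := ℤ × ℤ → Option T

namespace Config

variable {Sym : Type*} {T : Finset (TileType Sym)}

/-- The set of positions that carry a tile. -/
def dom (α : Config T) : Set (ℤ × ℤ) := {p | (α p).isSome}

/-- An assembly: a non-empty configuration whose domain has a connected full grid graph. -/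
def IsAssembly (α : Config T) : Prop :=
  α.dom.Nonempty ∧ (fullGridGraph α.dom).Connected

open Classical in
/-- The strength of the bond between the tile at `x` and the tile at `d.move x`. It is `0`, that is,
there is no edge of the binding graph, if one of the two positions is empty or
if the abutting glues differ in label or in strength, or have strength `0`. -/
noncomputable def bond (α : Config T) (x : ℤ × ℤ) (d : Dir) : ℕ :=
  match α x, α (d.move x) with
  | some s, some t => if s.1 d = t.1 d.opp then (s.1 d).strength else 0
  | _, _ => 0

/-- The weight of the cut-set of the binding graph of `α` that consists of the edges with exactly
one endpoint in `A`; each edge is listed once, from its endpoint in `A`.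
The sum may be infinite. -/
noncomputable def cutWeight (α : Config T) (A : Set (ℤ × ℤ)) : ℝ≥0∞ :=
  ∑' e : {e : (ℤ × ℤ) × Dir // e.1 ∈ A ∧ e.2.move e.1 ∉ A}, (α.bond e.1.1 e.1.2 : ℝ≥0∞)

/-- `τ`-stability: every cut-set of the binding graph, that is, the set of edges between the two
parts of a partition of the vertex set into two non-empty parts, has weight at least `τ`. -/
def IsStable (τ : ℕ) (α : Config T) : Prop :=
  ∀ A ⊆ α.dom, A.Nonempty → (α.dom \ A).Nonempty → (τ : ℝ≥0∞) ≤ α.cutWeight A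

/-- `α` is a subassembly of `β`. -/
def IsSub (α β : Config T) : Prop :=
  α.dom ⊆ β.dom ∧ ∀ p ∈ α.dom, α p = β p

end Config

/-- A tile assembly system: a finite tile set, a finite stable seed assembly, and a
positive temperature. -/
structure TAS (Sym : Type*) where
  tiles : Finset (TileType Sym)
  seed : Config tiles
  temp : ℕ
  temp_pos : 0 < temp
  seed_isAssembly : seed.IsAssembly
  seed_finite : seed.dom.Finite
  seed_stable : seed.IsStable temp

namespace TAS

variable {Sym : Type*} (𝒯 : TAS Sym)

/-- `α` produces `β` in one step. -/
def Step (α β : Config 𝒯.tiles) : Prop :=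
  (α.IsAssembly ∧ α.IsStable 𝒯.temp) ∧ (β.IsAssembly ∧ β.IsStable 𝒯.temp) ∧
    α.IsSub β ∧ (β.dom \ α.dom).encard = 1

/-- The first `k` terms of `f` form an assembly sequence (`k` may be infinite). -/
def IsAssemblySeq (f : ℕ → Config 𝒯.tiles) (k : ℕ∞) : Prop :=
  (∀ i : ℕ, (i : ℕ∞) < k → (f i).IsAssembly) ∧
    ∀ i : ℕ, ((i + 1 : ℕ) : ℕ∞) < k → 𝒯.Step (f i) (f (i + 1))

/-- `α` produces `β` in zero or more (possibly infinitely many) steps. -/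
def Produces (α β : Config 𝒯.tiles) : Prop :=
  ∃ (f : ℕ → Config 𝒯.tiles) (k : ℕ∞),
    k = (β.dom \ α.dom).encard + 1 ∧ 𝒯.IsAssemblySeq f k ∧
      f 0 = α ∧
      β.dom = ⋃ (i : ℕ) (_ : (i : ℕ∞) < k), (f i).dom ∧
      ∀ i : ℕ, (i : ℕ∞) < k → (f i).IsSub β

/-- `α` is producible. -/
def Producible (α : Config 𝒯.tiles) : Prop := 𝒯.Produces 𝒯.seed α

/-- The frontier of `α`: the empty positions at which a tile can stably attach to `α`. -/
def frontier (α : Config 𝒯.tiles) : Set (ℤ × ℤ) :=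
  ⋃ (β : Config 𝒯.tiles) (_ : 𝒯.Step α β), β.dom \ α.dom

/-- `α` is terminal. -/
def IsTerminal (α : Config 𝒯.tiles) : Prop :=
  α.IsAssembly ∧ α.IsStable 𝒯.temp ∧ 𝒯.frontier α = ∅

/-- `𝒯` strictly self-assembles `X`: every producible terminal assembly has domain `X`. -/
def StrictlySelfAssembles (X : Set (ℤ × ℤ)) : Prop :=
  ∀ α : Config 𝒯.tiles, 𝒯.Producible α → 𝒯.IsTerminal α → α.dom = X

end TAS

/-- The `c`-scaling of a set of points. For `0 < c`, integer division by `c` is the floor of the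
rational quotient. -/
def scaling (c : ℕ) (X : Set (ℤ × ℤ)) : Set (ℤ × ℤ) :=
  {p | (p.1 / (c : ℤ), p.2 / (c : ℤ)) ∈ X}

/-! ### Pier fractals -/

/-- The square of side `g` with south-west corner at the origin. -/
def square (g : ℕ) : Set (ℤ × ℤ) :=
  {p | 0 ≤ p.1 ∧ p.1 < g ∧ 0 ≤ p.2 ∧ p.2 < g}

/-- `G` is admissible as the generator of a `g`-discrete self-similar fractal. -/
structure IsGenerator (g : ℕ) (G : Set (ℤ × ℤ)) : Prop where
  one_lt : 1 < g
  origin_ssubset : {((0 : ℤ), (0 : ℤ))} ⊂ G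
  ssubset_square : G ⊂ square g
  column : ∀ x : ℤ, 0 ≤ x → x < g → ∃ y : ℤ, (x, y) ∈ G
  row : ∀ y : ℤ, 0 ≤ y → y < g → ∃ x : ℤ, (x, y) ∈ G

/-- `stage g G i` is stage number `i + 1` of the fractal: the first stage is `G`, and each further
stage is `X + g ^ i G`, where `X` is the preceding stage, number `i`. -/
def stage (g : ℕ) (G : Set (ℤ × ℤ)) : ℕ → Set (ℤ × ℤ)
  | 0 => G
  | i + 1 => {p | ∃ m ∈ stage g G i, ∃ n ∈ G, p = m + (g : ℤ) ^ (i + 1) • n}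

/-- The union of all stages. -/
def selfSimilarSet (g : ℕ) (G : Set (ℤ × ℤ)) : Set (ℤ × ℤ) := ⋃ i : ℕ, stage g G i

/-- The number of h-bridges of a non-empty finite set: the subsets that consist of a point in the
leftmost column and the point of the rightmost column in the same row. -/
noncomputable def nhb (S : Set (ℤ × ℤ)) : ℕ :=
  {B : Set (ℤ × ℤ) | B ⊆ S ∧
    ∃ y : ℤ, B = {(sInf (Prod.fst '' S), y), (sSup (Prod.fst '' S), y)}}.ncard

/-- The number of v-bridges of a non-empty finite set: the subsets that consist of a point in the
bottom row and the point of the top row in the same column. -/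
noncomputable def nvb (S : Set (ℤ × ℤ)) : ℕ :=
  {B : Set (ℤ × ℤ) | B ⊆ S ∧
    ∃ x : ℤ, B = {(x, sInf (Prod.snd '' S)), (x, sSup (Prod.snd '' S))}}.ncard

/-- A pier of `G`: a point of `G` that is `D`-free in `G` for exactly three directions `D`. -/
def IsPier (G : Set (ℤ × ℤ)) (p : ℤ × ℤ) : Prop :=
  p ∈ G ∧ {d : Dir | d.move p ∉ G}.ncard = 3

/-- A pier fractal: a discrete self-similar fractal whose generator is connected, has exactly one
h-bridge and exactly one v-bridge, and contains at least one pier. -/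
def IsPierFractal (P : Set (ℤ × ℤ)) : Prop :=
  ∃ (g : ℕ) (G : Set (ℤ × ℤ)), IsGenerator g G ∧ P = selfSimilarSet g G ∧
    (fullGridGraph G).Connected ∧ nhb G = 1 ∧ nvb G = 1 ∧ ∃ p, IsPier G p

/-!
Let `P` be a pier fractal with generator `G` of side `g`. Then `P` consists of the points all of
whose pairs of base `g` digits lie in `G`.

Since `G` has a single h-bridge and a single v-bridge, two adjacent blocks of side `g ^ s` that both
meet `P` are joined by exactly one pair of adjacent points of `P` (`existsUnique_isCrossing`). The
pier yields a point `q ≠ 0` of `P` with exactly one neighbour in `P`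
(`IsGenerator.exists_existsUnique_move_mem`): one takes a copy of the pier, and if bridges end at
the pier, a copy at which those bridges lead out of `P`. So for each `s`, the part of `P` in the
block `q` of side `g ^ s` is linked to the rest of `P` by a single edge, and after scaling by `c` by
an edge of width `c`.

Suppose a tile assembly system strictly self-assembles the scaling of `P`. Every reachable assembly
grows into a terminal one (`TAS.exists_produces_isTerminal`), so no tile is ever placed outside the
scaling. Consider one terminal assembly with its attachment times. For all large `s`, the seed is
outside the block of side `c g ^ s`, and everything in the block grows through its bridge. Only
finitely many combinations of tiles at the bridge and of the order of their attachment are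
possible, so for some `s < s'` they are the same. Then the growth in the larger block, translated
so that the bridges coincide, can take place in the smaller block instead. The larger block does
not fit into the smaller one, and the first tile that leaves the smaller block does not do so on the
side of the bridge, so that it is placed outside the scaling of `P` (`TAS.false_of_windows`).

To see that the combined growth is possible without building an assembly sequence by hand, a finite
configuration is called ordered if each tile outside the seed is held by neighbours of smaller
time, for some function from the plane to a linear order; ordered configurations are reachable
(`TAS.IsOrder.reflTransGen`). The combined configuration is ordered lexicographically by the number
of bridge tiles already present and the original attachment time.
-/

/-! ### Stability and the attachment of single tiles -/

instance : Fintype Dir :=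
  ⟨⟨([Dir.N, Dir.E, Dir.S, Dir.W] : List Dir), by simp⟩, by rintro (_ | _ | _ | _) <;> simp⟩

namespace Dir

@[simp] theorem opp_opp (d : Dir) : d.opp.opp = d := by cases d <;> rfl

theorem move_ne (d : Dir) (p : ℤ × ℤ) : d.move p ≠ p := by
  cases d <;> simp [move, Prod.ext_iff]

theorem move_left_injective (p : ℤ × ℤ) : Function.Injective (fun d : Dir => d.move p) := by
  rintro (_ | _ | _ | _) (_ | _ | _ | _) h <;> simp [move, Prod.ext_iff] at h ⊢ <;> omega

theorem move_add (d : Dir) (x v : ℤ × ℤ) : d.move (x + v) = d.move x + v := by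
  cases d <;> ext <;> simp [move] <;> ring

end Dir

namespace Config

variable {Sym : Type*} {T : Finset (TileType Sym)}

theorem bond_symm (α : Config T) (x : ℤ × ℤ) (d : Dir) :
    α.bond x d = α.bond (d.move x) d.opp := by
  unfold bond
  rw [Dir.move_opp]
  rcases α x with _ | s <;> rcases α (d.move x) with _ | t <;> simp only [Dir.opp_opp]
  by_cases h : s.1 d = t.1 d.opp
  · simp [h]
  · simp [h, Ne.symm h]

theorem bond_congr {α β : Config T} {x y : ℤ × ℤ} {d : Dir} (h : α x = β y)
    (h' : α (d.move x) = β (d.move y)) : α.bond x d = β.bond y d := by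
  unfold bond
  rw [h, h']

theorem mem_dom_of_bond_ne_zero {α : Config T} {x : ℤ × ℤ} {d : Dir} (h : α.bond x d ≠ 0) :
    x ∈ α.dom ∧ d.move x ∈ α.dom := by
  unfold bond at h
  simp only [dom, Set.mem_ofPred_eq]
  rcases hx : α x with _ | s <;> rcases hy : α (d.move x) with _ | t <;> simp_all

theorem bond_le_of_isSub {α β : Config T} (h : α.IsSub β) (x : ℤ × ℤ) (d : Dir) :
    α.bond x d ≤ β.bond x d := by
  by_cases h0 : α.bond x d = 0
  · simp [h0]
  · obtain ⟨hx, hy⟩ := mem_dom_of_bond_ne_zero h0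
    exact (bond_congr (h.2 _ hx) (h.2 _ hy)).le

theorem IsSub.refl (α : Config T) : α.IsSub α := ⟨subset_rfl, fun _ _ => rfl⟩

theorem IsSub.trans {α β γ : Config T} (h : α.IsSub β) (h' : β.IsSub γ) : α.IsSub γ :=
  ⟨h.1.trans h'.1, fun p hp => (h.2 p hp).trans (h'.2 p (h.1 hp))⟩

theorem cutWeight_eq (α : Config T) (A : Set (ℤ × ℤ)) :
    α.cutWeight A = ∑' e : (ℤ × ℤ) × Dir,
      Set.indicator {e : (ℤ × ℤ) × Dir | e.1 ∈ A ∧ e.2.move e.1 ∉ A}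
        (fun e => (α.bond e.1 e.2 : ℝ≥0∞)) e :=
  tsum_subtype {e : (ℤ × ℤ) × Dir | e.1 ∈ A ∧ e.2.move e.1 ∉ A}
        (fun e => (α.bond e.1 e.2 : ℝ≥0∞))

/-- A cut of a larger configuration weighs at least as much as the cut it induces on a
subassembly. -/
theorem cutWeight_inter_dom_le {α β : Config T} (h : α.IsSub β) (A : Set (ℤ × ℤ)) :
    α.cutWeight (A ∩ α.dom) ≤ β.cutWeight A := by
  rw [cutWeight_eq, cutWeight_eq]
  refine ENNReal.tsum_le_tsum fun e => ?_
  by_cases h0 : α.bond e.1 e.2 = 0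
  · simp [Set.indicator, h0]
  obtain ⟨hx, hy⟩ := mem_dom_of_bond_ne_zero h0
  by_cases he : e.1 ∈ A ∩ α.dom ∧ e.2.move e.1 ∉ A ∩ α.dom
  · have he' : e.1 ∈ A ∧ e.2.move e.1 ∉ A := ⟨he.1.1, fun h => he.2 ⟨h, hy⟩⟩
    simp only [Set.indicator, Set.mem_ofPred_eq, he, he', not_false_eq_true, and_self, if_true]
    exact_mod_cast bond_le_of_isSub h _ _
  · refine (Set.indicator_of_notMem (s := {e : (ℤ × ℤ) × Dir |
      e.1 ∈ A ∩ α.dom ∧ e.2.move e.1 ∉ A ∩ α.dom}) he _).trans_le zero_le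

theorem cutWeight_singleton (α : Config T) (p : ℤ × ℤ) :
    α.cutWeight {p} = ((∑ d : Dir, α.bond p d : ℕ) : ℝ≥0∞) := by
  let e : Dir ≃ {e : (ℤ × ℤ) × Dir //
      e.1 ∈ ({p} : Set (ℤ × ℤ)) ∧ e.2.move e.1 ∉ ({p} : Set (ℤ × ℤ))} :=
    { toFun := fun d => ⟨(p, d), by simp [Dir.move_ne]⟩
      invFun := fun e => e.1.2
      left_inv := fun d => rfl
      right_inv := by
        rintro ⟨⟨x, d⟩, hx, hd⟩
        obtain rfl : x = p := by simpa using hx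
        rfl }
  unfold cutWeight
  rw [← e.tsum_eq, tsum_fintype]
  push_cast
  rfl

/-- The bonds of the tile at `p` all belong to the cut-set that separates `p` from the rest. -/
theorem sum_bond_le_cutWeight (α : Config T) {p : ℤ × ℤ} {A : Set (ℤ × ℤ)} (hp : p ∉ A)
    (hA : α.dom ⊆ insert p A) :
    ((∑ d : Dir, α.bond p d : ℕ) : ℝ≥0∞) ≤ α.cutWeight A := by
  have hinj : Function.Injective (fun d : Dir => (d.move p, d.opp)) := fun d d' h =>
    Dir.move_left_injective p (Prod.ext_iff.1 h).1
  rw [cutWeight_eq]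
  refine le_trans ?_ (ENNReal.tsum_comp_le_tsum_of_injective hinj _)
  rw [tsum_fintype]
  push_cast
  refine Finset.sum_le_sum fun d _ => ?_
  by_cases h0 : α.bond p d = 0
  · simp [h0]
  have hy := hA (mem_dom_of_bond_ne_zero h0).2
  have hy' : d.move p ∈ A := hy.resolve_left (d.move_ne p)
  rw [Set.indicator_of_mem (by simpa [Dir.move_opp] using ⟨hy', hp⟩), bond_symm]

/-- Attaching one tile with sufficient strength preserves stability: a cut of the new binding graph
either contains a cut of the old one or separates the new tile from all others. -/
theorem isStable_of_attach {τ : ℕ} {α β : Config T} {p : ℤ × ℤ} (hα : α.IsStable τ)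
    (hsub : α.IsSub β) (hdom : β.dom = insert p α.dom)
    (hw : τ ≤ ∑ d : Dir, β.bond p d) : β.IsStable τ := by
  intro A hA hne hco
  have hw' : (τ : ℝ≥0∞) ≤ ((∑ d : Dir, β.bond p d : ℕ) : ℝ≥0∞) := by exact_mod_cast hw
  by_cases h1 : (A ∩ α.dom).Nonempty
  · by_cases h2 : (α.dom \ (A ∩ α.dom)).Nonempty
    · exact (hα _ Set.inter_subset_right h1 h2).trans (cutWeight_inter_dom_le hsub A)
    · have h3 : α.dom ⊆ A := fun x hx => by
        by_contra hxA
        exact h2 ⟨x, hx, fun h => hxA h.1⟩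
      have hp : p ∉ A := fun hp => by
        obtain ⟨x, hx, hxA⟩ := hco
        rw [hdom] at hx
        rcases hx with rfl | hx
        exacts [hxA hp, hxA (h3 hx)]
      exact hw'.trans (sum_bond_le_cutWeight β hp (hdom ▸ Set.insert_subset_insert h3))
  · have : A = {p} := by
      refine hne.subset_singleton_iff.1 fun x hx => ?_
      have := hdom ▸ hA hx
      exact this.resolve_right fun h => h1 ⟨x, hx, h⟩
    rw [this, cutWeight_singleton]
    exact hw'

theorem isAssembly_of_attach {α β : Config T} {p : ℤ × ℤ} (hα : α.IsAssembly)
    (hdom : β.dom = insert p α.dom) (hw : 0 < ∑ d : Dir, β.bond p d) : β.IsAssembly := by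
  obtain ⟨d, -, hd⟩ := Finset.exists_ne_zero_of_sum_ne_zero hw.ne'
  have hy : d.move p ∈ α.dom :=
    (hdom ▸ (mem_dom_of_bond_ne_zero hd).2 : d.move p ∈ insert p α.dom).resolve_left (d.move_ne p)
  refine ⟨hdom ▸ Set.insert_nonempty _ _, ?_⟩
  have h1 := SimpleGraph.induce_pair_connected_of_adj (G := gridGraph) ⟨d, rfl⟩
    (u := p) (v := d.move p)
  have h2 : β.dom = {p, d.move p} ∪ α.dom := by
    rw [hdom, Set.insert_union, Set.singleton_union, Set.insert_eq_of_mem hy]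
  rw [h2]
  exact SimpleGraph.induce_union_connected h1.preconnected hα.2.preconnected ⟨d.move p, by simp, hy⟩

end Config

namespace TAS

variable {Sym : Type*} (𝒯 : TAS Sym)

open Config

variable {𝒯} in
theorem Step.exists_attach {α β : Config 𝒯.tiles} (h : 𝒯.Step α β) :
    ∃ p, p ∉ α.dom ∧ β.dom = insert p α.dom ∧ 𝒯.temp ≤ ∑ d : Dir, β.bond p d := by
  obtain ⟨⟨hα, -⟩, ⟨-, hβ⟩, hsub, h1⟩ := h
  obtain ⟨p, hp⟩ := Set.encard_eq_one.1 h1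
  have hp' : p ∈ β.dom \ α.dom := hp ▸ rfl
  refine ⟨p, hp'.2, ?_, ?_⟩
  · rw [← Set.sdiff_union_of_subset hsub.1, hp, Set.singleton_union]
  · have := hβ {p} (by simpa using hp'.1) (Set.singleton_nonempty p) (by
      obtain ⟨x, hx⟩ := hα.1
      exact ⟨x, hsub.1 hx, fun h => hp'.2 (h ▸ hx)⟩)
    rw [cutWeight_singleton] at this
    exact_mod_cast this

theorem step_of_attach {α β : Config 𝒯.tiles} {p : ℤ × ℤ} (hα : α.IsAssembly)
    (hα' : α.IsStable 𝒯.temp) (hsub : α.IsSub β) (hp : p ∉ α.dom)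
    (hdom : β.dom = insert p α.dom) (hw : 𝒯.temp ≤ ∑ d : Dir, β.bond p d) : 𝒯.Step α β := by
  refine ⟨⟨hα, hα'⟩, ⟨isAssembly_of_attach hα hdom (𝒯.temp_pos.trans_le hw),
    isStable_of_attach hα' hsub hdom hw⟩, hsub, ?_⟩
  rw [hdom, Set.insert_sdiff_of_notMem _ hp, Set.sdiff_self]
  simp

end TAS

namespace TAS

variable {Sym : Type*} {𝒯 : TAS Sym}

open Config

theorem Step.finite_dom {α β : Config 𝒯.tiles} (h : 𝒯.Step α β) (hα : α.dom.Finite) :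
    β.dom.Finite := by
  obtain ⟨p, -, hd, -⟩ := h.exists_attach
  exact hd ▸ hα.insert p

/-! ### Every producible assembly grows into a terminal one -/

/-- A single step can be put in front of an assembly sequence. -/
theorem Step.produces {α β γ : Config 𝒯.tiles} (h : 𝒯.Step α β) (h' : 𝒯.Produces β γ) :
    𝒯.Produces α γ := by
  obtain ⟨f, k, hk, ⟨hf1, hf2⟩, hf0, hdom, hsub⟩ := h'
  have hk0 : 0 < k := by rw [hk]; simp
  have hβγ : β.IsSub γ := hf0 ▸ hsub 0 (by simpa using hk0)
  obtain ⟨p, hp, hd, -⟩ := h.exists_attach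
  have lt_iff (i : ℕ) : ((i + 1 : ℕ) : ℕ∞) < k + 1 ↔ (i : ℕ∞) < k := by
    push_cast
    exact ENat.add_lt_add_iff_right (by simp)
  refine ⟨fun i => i.casesOn α f, k + 1, ?_, ⟨?_, ?_⟩, rfl, ?_, ?_⟩
  · rw [hk]
    congr 1
    have : γ.dom \ α.dom = insert p (γ.dom \ β.dom) := by
      have hpγ : p ∈ γ.dom := hβγ.1 (hd ▸ Set.mem_insert _ _)
      ext x
      simp only [hd, Set.mem_sdiff, Set.mem_insert_iff]
      by_cases hx : x = p
      · subst hx; simp [hp, hpγ]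
      · simp [hx]
    rw [this, Set.encard_insert_of_notMem]
    simp [hd]
  · rintro (_ | i) hi
    · exact h.1.1
    · exact hf1 i ((lt_iff i).1 hi)
  · rintro (_ | i) hi
    · simpa [hf0] using h
    · exact hf2 i ((lt_iff (i + 1)).1 hi)
  · rw [hdom]
    ext x
    simp only [Set.mem_iUnion]
    constructor
    · rintro ⟨i, hi, hx⟩
      exact ⟨i + 1, (lt_iff i).2 hi, hx⟩
    · rintro ⟨_ | i, hi, hx⟩
      · exact ⟨0, by simpa using hk0, hf0 ▸ h.2.2.1.1 hx⟩
      · exact ⟨i, (lt_iff i).1 hi, hx⟩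
  · rintro (_ | i) hi
    · exact h.2.2.1.trans hβγ
    · exact hsub i ((lt_iff i).1 hi)

theorem produces_refl {α : Config 𝒯.tiles} (h : α.IsAssembly) : 𝒯.Produces α α := by
  refine ⟨fun _ => α, 1, by simp, ⟨fun _ _ => h, fun i hi => ?_⟩, rfl, ?_, fun _ _ => .refl α⟩
  · exact absurd hi (by push_cast; simp)
  · ext x
    simp only [Set.mem_iUnion, exists_prop]
    exact ⟨fun hx => ⟨0, by simp, hx⟩, fun ⟨_, _, hx⟩ => hx⟩

theorem Produces.isSub {α β : Config 𝒯.tiles} (h : 𝒯.Produces α β) : α.IsSub β := by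
  obtain ⟨f, k, hk, -, hf0, -, hsub⟩ := h
  exact hf0 ▸ hsub 0 (by rw [hk]; simp)

section Limit

variable {f : ℕ → Config 𝒯.tiles}

open Classical in
/-- The union of an increasing sequence of configurations. -/
noncomputable def limit (f : ℕ → Config 𝒯.tiles) : Config 𝒯.tiles := fun p =>
  if h : ∃ i, p ∈ (f i).dom then f h.choose p else none

theorem isSub_of_le (hf : ∀ i, 𝒯.Step (f i) (f (i + 1))) {i j : ℕ} (h : i ≤ j) :
    (f i).IsSub (f j) := by
  induction j, h using Nat.le_induction with
  | base => exact .refl _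
  | succ j _ ih => exact ih.trans (hf j).2.2.1

theorem isSub_limit (hf : ∀ i, 𝒯.Step (f i) (f (i + 1))) (i : ℕ) : (f i).IsSub (limit f) := by
  have key : ∀ p ∈ (f i).dom, f i p = limit f p := fun p hp => by
    have h : ∃ i, p ∈ (f i).dom := ⟨i, hp⟩
    rw [limit, dif_pos h]
    rcases le_total i h.choose with hle | hle
    · exact (isSub_of_le hf hle).2 p hp
    · exact ((isSub_of_le hf hle).2 p h.choose_spec).symm
  refine ⟨fun p hp => ?_, key⟩
  have := key p hp
  simp only [dom, Set.mem_ofPred_eq] at hp ⊢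
  rwa [← this]

theorem mem_dom_limit {p : ℤ × ℤ} (h : p ∈ (limit f).dom) : ∃ i, p ∈ (f i).dom := by
  by_contra hc
  have hnone : limit f p = none := dif_neg hc
  simp [dom, hnone] at h

theorem isAssembly_limit (hf : ∀ i, 𝒯.Step (f i) (f (i + 1))) : (limit f).IsAssembly := by
  have hd : (limit f).dom = ⋃₀ Set.range fun i => (f i).dom := by
    ext x
    simp only [Set.sUnion_range, Set.mem_iUnion]
    exact ⟨mem_dom_limit, fun ⟨i, hi⟩ => (isSub_limit hf i).1 hi⟩
  have h0 : (f 0).dom.Nonempty := (hf 0).1.1.1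
  refine ⟨h0.mono (isSub_limit hf 0).1, ?_⟩
  rw [hd]
  refine SimpleGraph.induce_sUnion_connected_of_pairwise_not_disjoint (Set.range_nonempty _) ?_ ?_
  · rintro _ _ ⟨i, rfl⟩ ⟨j, rfl⟩
    exact h0.mono fun x hx => ⟨(isSub_of_le hf (Nat.zero_le i)).1 hx,
      (isSub_of_le hf (Nat.zero_le j)).1 hx⟩
  · rintro _ ⟨i, rfl⟩
    exact (hf i).1.1.2

theorem isStable_limit (hf : ∀ i, 𝒯.Step (f i) (f (i + 1))) : (limit f).IsStable 𝒯.temp := by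
  rintro A hA ⟨x, hx⟩ ⟨y, hy, hyA⟩
  obtain ⟨i, hi⟩ := mem_dom_limit (hA hx)
  obtain ⟨j, hj⟩ := mem_dom_limit hy
  have hi' := (isSub_of_le hf (le_max_left i j)).1 hi
  have hj' := (isSub_of_le hf (le_max_right i j)).1 hj
  exact ((hf (max i j)).1.2 _ Set.inter_subset_right ⟨x, hx, hi'⟩
    ⟨y, hj', fun h => hyA h.1⟩).trans (cutWeight_inter_dom_le (isSub_limit hf _) A)

theorem produces_limit (hf : ∀ i, 𝒯.Step (f i) (f (i + 1))) : 𝒯.Produces (f 0) (limit f) := by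
  have hcard : ∀ i : ℕ, (i : ℕ∞) ≤ ((f i).dom \ (f 0).dom).encard := by
    intro i
    induction i with
    | zero => simp
    | succ i ih =>
      obtain ⟨p, hp, hd, -⟩ := (hf i).exists_attach
      have hp0 : p ∉ (f 0).dom := fun h => hp ((isSub_of_le hf (Nat.zero_le i)).1 h)
      rw [hd, Set.insert_sdiff_of_notMem _ hp0, Set.encard_insert_of_notMem fun h => hp h.1]
      push_cast
      gcongr
  have htop : ((limit f).dom \ (f 0).dom).encard = ⊤ := by
    refine ENat.eq_top_iff_forall_ge.2 fun n => (hcard n).trans (Set.encard_le_encard ?_)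
    exact Set.sdiff_subset_sdiff_left (isSub_limit hf n).1
  refine ⟨f, ⊤, by rw [htop]; rfl, ⟨fun i _ => (hf i).1.1, fun i _ => hf i⟩, rfl, ?_,
    fun i _ => isSub_limit hf i⟩
  ext x
  simp only [Set.mem_iUnion, exists_prop]
  exact ⟨fun h => (mem_dom_limit h).imp fun i hi => ⟨ENat.natCast_lt_top i, hi⟩,
    fun ⟨i, _, hi⟩ => (isSub_limit hf i).1 hi⟩

/-- A position at which a tile can attach to the limit lies in the frontier of all late terms: the
bonds that hold the tile come from its at most four neighbours. -/
theorem exists_mem_frontier_of_limit (hf : ∀ i, 𝒯.Step (f i) (f (i + 1))) {p : ℤ × ℤ}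
    (hp : p ∈ 𝒯.frontier (limit f)) : ∃ N, ∀ i ≥ N, p ∈ 𝒯.frontier (f i) := by
  classical
  simp only [frontier, Set.mem_iUnion] at hp
  obtain ⟨β, hβ, hpβ, hpl⟩ := hp
  obtain ⟨p', -, hd, hw⟩ := hβ.exists_attach
  obtain rfl : p = p' := (hd ▸ hpβ : p ∈ insert p' (limit f).dom).resolve_right hpl
  have hnb : ∀ d : Dir, ∃ N, d.move p ∈ (limit f).dom → d.move p ∈ (f N).dom := fun d => by
    by_cases h : d.move p ∈ (limit f).dom
    · exact (mem_dom_limit h).imp fun i hi _ => hi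
    · exact ⟨0, fun h' => absurd h' h⟩
  choose N hN using hnb
  refine ⟨Finset.univ.sup N, fun i hi => ?_⟩
  have hpi : p ∉ (f i).dom := fun h => hpl ((isSub_limit hf i).1 h)
  let γ : Config 𝒯.tiles := Function.update (f i) p (β p)
  have hγ : ∀ x, x ≠ p → γ x = f i x := fun x hx => Function.update_of_ne hx _ _
  have hγp : γ p = β p := Function.update_self _ _ _
  have hγd : γ.dom = insert p (f i).dom := by
    ext x
    by_cases hx : x = p
    · subst hx
      simpa [dom, hγp] using hpβ
    · simp [dom, hγ x hx, hx]
  have hstep : 𝒯.Step (f i) γ := by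
    refine 𝒯.step_of_attach (hf i).1.1 (hf i).1.2 ⟨hγd ▸ Set.subset_insert _ _, fun x hx => ?_⟩
      hpi hγd (hw.trans (Finset.sum_le_sum fun d _ => ?_))
    · exact (hγ x (by rintro rfl; exact hpi hx)).symm
    · by_cases h0 : β.bond p d = 0
      · simp [h0]
      have h1 : d.move p ∈ (limit f).dom :=
        (hd ▸ (mem_dom_of_bond_ne_zero h0).2 :
          d.move p ∈ insert p (limit f).dom).resolve_left (d.move_ne p)
      have h2 : d.move p ∈ (f i).dom :=
        (isSub_of_le hf ((Finset.le_sup (Finset.mem_univ d)).trans hi)).1 (hN d h1)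
      refine (bond_congr hγp.symm ?_).le
      rw [hγ _ (d.move_ne p), (isSub_limit hf i).2 _ h2, hβ.2.2.1.2 _ h1]
  simp only [frontier, Set.mem_iUnion]
  exact ⟨γ, hstep, hγd ▸ Set.mem_insert _ _, hpi⟩

end Limit

/-- Every stable assembly grows into a terminal one: at each step, a tile is attached at the
frontier position that comes first in a fixed enumeration of the plane, so that no position stays
in the frontier forever. -/
theorem exists_produces_isTerminal {α : Config 𝒯.tiles} (hα : α.IsAssembly)
    (hα' : α.IsStable 𝒯.temp) : ∃ β, 𝒯.Produces α β ∧ 𝒯.IsTerminal β := by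
  classical
  by_contra hno
  push Not at hno
  have hnext : ∀ γ : {γ : Config 𝒯.tiles // (γ.IsAssembly ∧ γ.IsStable 𝒯.temp) ∧
        ∀ β, 𝒯.Produces γ β → ¬ 𝒯.IsTerminal β},
      ∃ δ : {γ : Config 𝒯.tiles // (γ.IsAssembly ∧ γ.IsStable 𝒯.temp) ∧
        ∀ β, 𝒯.Produces γ β → ¬ 𝒯.IsTerminal β},
      𝒯.Step γ.1 δ.1 ∧ ∃ p ∈ δ.1.dom \ γ.1.dom,
        ∀ p' ∈ 𝒯.frontier γ.1, Encodable.encode p ≤ Encodable.encode p' := by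
    rintro ⟨γ, ⟨h1, h2⟩, h3⟩
    have hne : (𝒯.frontier γ).Nonempty := by
      by_contra hne
      exact h3 γ (produces_refl h1) ⟨h1, h2, Set.not_nonempty_iff_eq_empty.1 hne⟩
    obtain ⟨_, ⟨p, hp, rfl⟩, hmin⟩ := WellFounded.has_min (wellFounded_lt (α := ℕ))
      (Encodable.encode '' 𝒯.frontier γ) (hne.image _)
    have hp' := hp
    simp only [frontier, Set.mem_iUnion] at hp'
    obtain ⟨δ, hδ, hpδ⟩ := hp'
    exact ⟨⟨δ, hδ.2.1, fun β hβ => h3 β (hδ.produces hβ)⟩, hδ, p, hpδ,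
      fun p' hp' => not_lt.1 (hmin _ ⟨p', hp', rfl⟩)⟩
  choose next hstep p hp hmin using hnext
  let F := fun n : ℕ => next^[n] ⟨α, ⟨hα, hα'⟩, hno⟩
  have hF : ∀ n, F (n + 1) = next (F n) := fun n => Function.iterate_succ_apply' _ _ _
  have hf : ∀ i, 𝒯.Step (F i).1 (F (i + 1)).1 := fun i => by rw [hF]; exact hstep _
  refine hno _ (produces_limit (f := fun i => (F i).1) hf)
    ⟨isAssembly_limit hf, isStable_limit hf, ?_⟩
  by_contra hne
  obtain ⟨x, hx⟩ := Set.nonempty_iff_ne_empty.2 hne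
  obtain ⟨N, hN⟩ := exists_mem_frontier_of_limit hf hx
  have hinj : Function.Injective fun i => p (F i) := by
    refine Function.Injective.of_lt_imp_ne fun i j hij h => ?_
    have h1 : p (F i) ∈ (F (i + 1)).1.dom := by rw [hF]; exact (hp (F i)).1
    have h2 := (isSub_of_le (f := fun i => (F i).1) hf (Nat.succ_le_of_lt hij)).1 h1
    exact (hp (F j)).2 ((congrArg (· ∈ (F j).1.dom) h).mp h2)
  have hinj' : Function.Injective fun i => Encodable.encode (p (F (N + i))) :=
    Encodable.encode_injective.comp (hinj.comp (add_right_injective N))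
  refine Set.infinite_range_of_injective hinj' ((Set.finite_Iic (Encodable.encode x)).subset ?_)
  rintro _ ⟨i, rfl⟩
  exact hmin _ x (hN _ (Nat.le_add_right N i))

theorem produces_of_reflTransGen {α β γ : Config 𝒯.tiles}
    (h : Relation.ReflTransGen 𝒯.Step α β) (h' : 𝒯.Produces β γ) : 𝒯.Produces α γ := by
  induction h using Relation.ReflTransGen.head_induction_on with
  | refl => exact h'
  | head h _ ih => exact h.produces ih

theorem isAssembly_and_isStable_of_reflTransGen {β : Config 𝒯.tiles}
    (h : Relation.ReflTransGen 𝒯.Step 𝒯.seed β) : β.IsAssembly ∧ β.IsStable 𝒯.temp := by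
  rcases h.cases_tail with rfl | ⟨γ, -, h⟩
  exacts [⟨𝒯.seed_isAssembly, 𝒯.seed_stable⟩, h.2.1]

/-- Nothing is ever placed outside a strictly self-assembled set, since every reachable assembly
grows into a terminal one. -/
theorem StrictlySelfAssembles.dom_subset {X : Set (ℤ × ℤ)} (hX : 𝒯.StrictlySelfAssembles X)
    {γ : Config 𝒯.tiles} (h : Relation.ReflTransGen 𝒯.Step 𝒯.seed γ) : γ.dom ⊆ X := by
  obtain ⟨h1, h2⟩ := isAssembly_and_isStable_of_reflTransGen h
  obtain ⟨β, hβ, hβ'⟩ := exists_produces_isTerminal h1 h2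
  rw [← hX β (produces_of_reflTransGen h hβ) hβ']
  exact hβ.isSub.1

/-! ### Attachment times -/

/-- `t` orders `γ`: each tile outside the seed is held, with strength at least the temperature,
by its neighbours of smaller `t`. -/
def IsOrder {L : Type*} [LinearOrder L] (𝒯 : TAS Sym) (γ : Config 𝒯.tiles) (t : ℤ × ℤ → L) :
    Prop :=
  ∀ p ∈ γ.dom, p ∉ 𝒯.seed.dom →
    𝒯.temp ≤ ∑ d : Dir, if t (d.move p) < t p then γ.bond p d else 0

/-- The attachment times of an assembly sequence order its result. -/
theorem Produces.exists_isOrder {β : Config 𝒯.tiles} (h : 𝒯.Produces 𝒯.seed β) :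
    ∃ t : ℤ × ℤ → ℕ, 𝒯.IsOrder β t ∧ (∀ p ∈ 𝒯.seed.dom, t p = 0) ∧
      ∀ N, {p | p ∈ β.dom ∧ t p ≤ N}.Finite := by
  obtain ⟨f, k, hk, ⟨-, hf⟩, hf0, hdom, hsub⟩ := h
  have hk0 : ((0 : ℕ) : ℕ∞) < k := by rw [hk]; simp
  let S : ℤ × ℤ → Set ℕ := fun p => {i | (i : ℕ∞) < k ∧ p ∈ (f i).dom}
  have hS : ∀ p ∈ β.dom, sInf (S p) ∈ S p := fun p hp => by
    rw [hdom] at hp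
    simp only [Set.mem_iUnion] at hp
    obtain ⟨i, hi, hp⟩ := hp
    exact Nat.sInf_mem ⟨i, hi, hp⟩
  have hmono : ∀ i j : ℕ, i ≤ j → (j : ℕ∞) < k → (f i).IsSub (f j) := fun i j hij => by
    induction j, hij using Nat.le_induction with
    | base => exact fun _ => .refl _
    | succ j _ ih =>
      exact fun hj => (ih ((by exact_mod_cast j.lt_succ_self : (j : ℕ∞) < (j + 1 : ℕ)).trans
        hj)).trans (hf j hj).2.2.1
  have hfin : ∀ i : ℕ, (i : ℕ∞) < k → (f i).dom.Finite := fun i => by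
    induction i with
    | zero => exact fun _ => hf0 ▸ 𝒯.seed_finite
    | succ i ih =>
      exact fun hi => (hf i hi).finite_dom
        (ih ((by exact_mod_cast i.lt_succ_self : (i : ℕ∞) < (i + 1 : ℕ)).trans hi))
  refine ⟨fun p => sInf (S p), fun p hp hps => ?_, fun p hp => ?_, fun N => ?_⟩
  · obtain ⟨hlt, hmem⟩ := hS p hp
    obtain ⟨i, hi⟩ : ∃ i, sInf (S p) = i + 1 := by
      refine Nat.exists_eq_succ_of_ne_zero fun h0 => hps ?_
      rwa [h0, hf0] at hmem
    rw [hi] at hlt hmem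
    have hnot : p ∉ (f i).dom := fun h => by
      have : sInf (S p) ≤ i :=
        Nat.sInf_le ⟨(by exact_mod_cast i.lt_succ_self : (i : ℕ∞) < (i + 1 : ℕ)).trans hlt, h⟩
      omega
    obtain ⟨p', -, hd, hw⟩ := (hf i hlt).exists_attach
    obtain rfl : p = p' := (hd ▸ hmem : p ∈ insert p' (f i).dom).resolve_right hnot
    refine hw.trans (Finset.sum_le_sum fun d _ => ?_)
    by_cases h0 : (f (i + 1)).bond p d = 0
    · simp [h0]
    have h1 : d.move p ∈ (f i).dom :=
      (hd ▸ (mem_dom_of_bond_ne_zero h0).2 :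
        d.move p ∈ insert p (f i).dom).resolve_left (d.move_ne p)
    have h2 : sInf (S (d.move p)) ≤ i :=
      Nat.sInf_le ⟨(by exact_mod_cast i.lt_succ_self : (i : ℕ∞) < (i + 1 : ℕ)).trans hlt, h1⟩
    have h3 : sInf (S (d.move p)) < sInf (S p) := by omega
    rw [if_pos h3]
    exact bond_le_of_isSub (hsub _ hlt) _ _
  · exact Nat.eq_zero_of_le_zero (Nat.sInf_le ⟨hk0, hf0 ▸ hp⟩)
  · refine ((Set.finite_Iic N).biUnion (t := fun i => {p | (i : ℕ∞) < k ∧ p ∈ (f i).dom})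
      fun i _ => ?_).subset fun p hp => ?_
    · by_cases hi : (i : ℕ∞) < k
      · exact (hfin i hi).subset fun p hp => hp.2
      · exact Set.finite_empty.subset fun p hp => absurd hp.1 hi
    · simp only [Set.mem_iUnion]
      exact ⟨_, hp.2, hS p hp.1⟩

/-- A finite ordered configuration that extends the seed is reached by finitely many steps. -/
theorem IsOrder.reflTransGen {L : Type*} [LinearOrder L] {γ : Config 𝒯.tiles} {t : ℤ × ℤ → L}
    (hfin : γ.dom.Finite) (hseed : 𝒯.seed.IsSub γ) (ht : 𝒯.IsOrder γ t) :
    Relation.ReflTransGen 𝒯.Step 𝒯.seed γ := by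
  classical
  induction hn : (γ.dom \ 𝒯.seed.dom).ncard generalizing γ with
  | zero =>
    rw [Set.ncard_eq_zero (hfin.subset Set.sdiff_subset), Set.sdiff_eq_empty] at hn
    have : 𝒯.seed = γ := by
      funext p
      by_cases hp : p ∈ γ.dom
      · exact hseed.2 p (hn hp)
      · have hp' : p ∉ 𝒯.seed.dom := fun h => hp (hseed.1 h)
        simp only [dom, Set.mem_ofPred_eq, Option.not_isSome_iff_eq_none] at hp hp'
        rw [hp, hp']
    rw [this]
  | succ n ih =>
    have hfin' : (γ.dom \ 𝒯.seed.dom).Finite := hfin.subset Set.sdiff_subset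
    obtain ⟨p, ⟨hp, hps⟩, hmax⟩ := hfin'.exists_maximalFor t _
      (Set.nonempty_of_ncard_ne_zero (by omega))
    let δ : Config 𝒯.tiles := Function.update γ p none
    have hδp : δ p = none := Function.update_self _ _ _
    have hδ : ∀ x, x ≠ p → δ x = γ x := fun x hx => Function.update_of_ne hx _ _
    have hδd : δ.dom = γ.dom \ {p} := by
      ext x
      by_cases hx : x = p
      · subst hx; simp [dom, hδp]
      · simp [dom, hδ x hx, hx]
    have hseed' : 𝒯.seed.IsSub δ := by
      refine ⟨fun x hx => hδd ▸ ⟨hseed.1 hx, ?_⟩, fun x hx => ?_⟩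
      · rintro rfl; exact hps hx
      · rw [hδ x (by rintro rfl; exact hps hx), hseed.2 x hx]
    have hord : 𝒯.IsOrder δ t := fun q hq hqs => by
      have hq' : q ∈ γ.dom ∧ q ≠ p := by simpa [hδd] using hq
      refine (ht q hq'.1 hqs).trans (Finset.sum_le_sum fun d _ => ?_)
      split_ifs with hlt
      · refine (bond_congr (hδ q hq'.2).symm (hδ _ ?_).symm).le
        intro h
        have hqm : q ∈ γ.dom \ 𝒯.seed.dom := ⟨hq'.1, hqs⟩
        have hle : t q ≤ t p := (le_total _ _).elim id fun h' => hmax hqm h'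
        exact hle.not_gt (h ▸ hlt)
      · exact le_rfl
    have hcard : (δ.dom \ 𝒯.seed.dom).ncard = n := by
      have : δ.dom \ 𝒯.seed.dom = (γ.dom \ 𝒯.seed.dom) \ {p} := by
        rw [hδd, Set.sdiff_sdiff_comm]
      rw [this, Set.ncard_sdiff_singleton_of_mem (show p ∈ γ.dom \ 𝒯.seed.dom from ⟨hp, hps⟩), hn]
      rfl
    have hreach := ih (hfin.subset (hδd ▸ Set.sdiff_subset)) hseed' hord hcard
    obtain ⟨h1, h2⟩ := isAssembly_and_isStable_of_reflTransGen hreach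
    refine hreach.tail (𝒯.step_of_attach (β := γ) h1 h2
      ⟨hδd ▸ Set.sdiff_subset, fun x hx => hδ x ?_⟩
      (p := p) (by simp [hδd]) (by simp [hδd, Set.insert_eq_of_mem hp]) ?_)
    · rintro rfl; simp [hδd] at hx
    · refine (ht p hp hps).trans (Finset.sum_le_sum fun d _ => ?_)
      split_ifs <;> simp

/-! ### Replacing the growth inside a window -/

/-- No ordered assembly `β` with domain `X` admits two windows `W` and `W'` as follows, if all that
`𝒯` produces lies in `X`. All adjacencies of `X` across the border of `W` join points of the
finite set `B`, and those across the border of `W'` join points of `B + v`; the tiles at `B` and at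
`B + v` agree, and so does the order of their attachment; the translate of `W' ∩ X` by `-v` is not
inside `W`, and wherever it leaves `W` through one edge, it leaves `X`.

The reason is that the tiles outside `W` cannot tell the growth in `W` from the translated growth
in `W'`, so the latter can take place in `W`, until its first tile outside `W`, which is
outside `X`. -/
theorem false_of_windows {X : Set (ℤ × ℤ)}
    (hX : ∀ γ, Relation.ReflTransGen 𝒯.Step 𝒯.seed γ → γ.dom ⊆ X)
    {β : Config 𝒯.tiles} (hβ : β.dom = X) (hseed : 𝒯.seed.IsSub β)
    {t : ℤ × ℤ → ℕ} (ht : 𝒯.IsOrder β t) (ht0 : ∀ p ∈ 𝒯.seed.dom, t p = 0)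
    (htfin : ∀ N, {p | p ∈ β.dom ∧ t p ≤ N}.Finite)
    {W W' : Set (ℤ × ℤ)} (hW : ∀ x ∈ 𝒯.seed.dom, x ∉ W) (hW' : ∀ x ∈ 𝒯.seed.dom, x ∉ W')
    {v : ℤ × ℤ} {B : Finset (ℤ × ℤ)}
    (hB : ∀ x ∈ W, x ∈ X → ∀ d : Dir, d.move x ∈ X → d.move x ∉ W → x ∈ B ∧ d.move x ∈ B)
    (hB' : ∀ x, x + v ∈ W' → x + v ∈ X → ∀ d : Dir, d.move (x + v) ∈ X → d.move (x + v) ∉ W' →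
      x ∈ B ∧ d.move x ∈ B)
    (hBW : ∀ b ∈ B, b ∈ W ↔ b + v ∈ W') (htile : ∀ b ∈ B, β (b + v) = β b)
    (hord : ∀ b ∈ B, ∀ b' ∈ B, t b < t b' ↔ t (b + v) < t (b' + v))
    (hesc : ∃ x, x + v ∈ W' ∧ x + v ∈ X ∧ x ∉ W)
    (hout : ∀ x ∈ W, x + v ∈ W' → x + v ∈ X → ∀ d : Dir, d.move (x + v) ∈ W' →
      d.move x ∉ W → d.move x ∉ X) : False := by
  classical
  have hdom : ∀ x, x ∈ X ↔ (β x).isSome := fun x => by rw [← hβ]; rfl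
  -- `e` is the first tile of the growth in `W'` whose translate is outside `W`
  obtain ⟨e, ⟨heW', heX, heW⟩, hmin⟩ : ∃ e, (e + v ∈ W' ∧ e + v ∈ X ∧ e ∉ W) ∧
      ∀ x, x + v ∈ W' → x + v ∈ X → t (x + v) < t (e + v) → x ∈ W := by
    obtain ⟨e, he, hmin⟩ := WellFounded.has_min
      (InvImage.wf (fun x => t (x + v)) (wellFounded_lt (α := ℕ)))
      {x | x + v ∈ W' ∧ x + v ∈ X ∧ x ∉ W} hesc
    exact ⟨e, he, fun x h1 h2 h3 => by_contra fun h => hmin x ⟨h1, h2, h⟩ h3⟩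
  have heX' : e ∉ X := by
    have hsum := ht (e + v) (hβ ▸ heX) fun h => hW' _ h heW'
    obtain ⟨d, -, hd⟩ := Finset.exists_ne_zero_of_sum_ne_zero (𝒯.temp_pos.trans_le hsum).ne'
    rw [ite_ne_right_iff] at hd
    have hz : d.move (e + v) ∈ X := hβ ▸ (mem_dom_of_bond_ne_zero hd.2).2
    have hzW : d.move (e + v) ∈ W' := by
      by_contra hzW
      exact heW ((hBW e (hB' e heW' heX d hz hzW).1).2 heW')
    have hlt := hd.1
    rw [Dir.move_add] at hz hzW hlt
    have := hout (d.move e) (hmin _ hzW hz hlt) hzW hz d.opp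
    rw [← Dir.move_add, Dir.move_opp, Dir.move_opp] at this
    exact this heW' heW
  -- `key` and `key'` count the tiles at `B` and `B + v` that are already there
  let key : ℤ × ℤ → ℕ := fun x => (B.filter fun b => t b ≤ t x).card
  let key' : ℤ × ℤ → ℕ := fun x => (B.filter fun b => t (b + v) ≤ t (x + v)).card
  have key_mono : ∀ x y, t x ≤ t y → key x ≤ key y := fun x y h =>
    Finset.card_le_card (Finset.monotone_filter_right B fun _ _ hb => le_trans hb h)
  have key'_mono : ∀ x y, t (x + v) ≤ t (y + v) → key' x ≤ key' y := fun x y h =>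
    Finset.card_le_card (Finset.monotone_filter_right B fun _ _ hb => le_trans hb h)
  have key_lt : ∀ x, ∀ b ∈ B, t x < t b → key x < key b := fun x b hb h =>
    Finset.card_lt_card ⟨Finset.monotone_filter_right B fun _ _ hb => le_trans hb h.le,
      fun hs => (Finset.mem_filter.1 (hs (Finset.mem_filter.2 ⟨hb, le_rfl⟩))).2.not_gt h⟩
  have key'_lt : ∀ x, ∀ b ∈ B, t (x + v) < t (b + v) → key' x < key' b := fun x b hb h =>
    Finset.card_lt_card ⟨Finset.monotone_filter_right B fun _ _ hb => le_trans hb h.le,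
      fun hs => (Finset.mem_filter.1 (hs (Finset.mem_filter.2 ⟨hb, le_rfl⟩))).2.not_gt h⟩
  have key_eq : ∀ b ∈ B, key b = key' b := fun b hb => by
    refine congrArg Finset.card (Finset.filter_congr fun b' hb' => ?_)
    rw [← not_lt, ← not_lt, hord b hb b' hb']
  have lex_lt : ∀ a b c d : ℕ, a ≤ c → b < d → toLex (a, b) < toLex (c, d) := fun a b c d h h' => by
    rw [Prod.Lex.toLex_lt_toLex]
    rcases h.lt_or_eq with h | h
    exacts [.inl h, .inr ⟨h, h'⟩]
  have lex_lt' : ∀ a b c d : ℕ, a < c → toLex (a, b) < toLex (c, d) := fun a b c d h =>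
    Prod.Lex.toLex_lt_toLex.2 (.inl h)
  -- the translated growth in `W'` up to `e`, and the part of the growth outside `W` it depends on
  let I : Set (ℤ × ℤ) := {x | x + v ∈ W' ∧ x + v ∈ X ∧ (t (x + v) < t (e + v) ∨ x = e)}
  let O : Set (ℤ × ℤ) :=
    {x | x ∈ X ∧ x ∉ W ∧ (x ∈ 𝒯.seed.dom ∨ key x ≤ key' e) ∧ t x ≤ B.sup t}
  have hdisj : ∀ x, x ∈ X → x ∉ W → x ∉ I := by
    rintro x hxX hxW ⟨h1, h2, h3 | rfl⟩
    exacts [hxW (hmin x h1 h2 h3), heX' hxX]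
  have hI_le : ∀ x ∈ I, t (x + v) ≤ t (e + v) := by
    rintro x ⟨-, -, h | rfl⟩
    exacts [h.le, le_rfl]
  let γ : Config 𝒯.tiles := fun x => if x ∈ I then β (x + v) else if x ∈ O then β x else none
  let s : ℤ × ℤ → ℕ ×ₗ ℕ := fun x =>
    if x ∈ I then toLex (key' x, t (x + v)) else toLex (key x, t x)
  have γI : ∀ x ∈ I, γ x = β (x + v) := fun x hx => if_pos hx
  have γO : ∀ x, x ∉ I → x ∈ O → γ x = β x := fun x hx hx' => by simp only [γ, hx, hx', if_true,
    if_false]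
  have sI : ∀ x ∈ I, s x = toLex (key' x, t (x + v)) := fun x hx => if_pos hx
  have sO : ∀ x, x ∉ I → s x = toLex (key x, t x) := fun x hx => if_neg hx
  have hγdom : ∀ x ∈ γ.dom, x ∈ I ∨ x ∉ I ∧ x ∈ O := fun x hx => by
    by_cases h : x ∈ I
    · exact .inl h
    · by_cases h' : x ∈ O
      · exact .inr ⟨h, h'⟩
      · simp [dom, γ, h, h'] at hx
  have hfin : γ.dom.Finite := by
    have hOfin : O.Finite := (htfin (B.sup t)).subset fun x hx => ⟨hβ ▸ hx.1, hx.2.2.2⟩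
    have hIfin : I.Finite := by
      refine ((htfin (t (e + v))).preimage (f := (· + v)) (add_left_injective v).injOn).subset ?_
      exact fun x hx => ⟨hβ ▸ hx.2.1, hI_le x hx⟩
    exact (hIfin.union hOfin).subset fun x hx => (hγdom x hx).imp id And.right
  have hsub : 𝒯.seed.IsSub γ := by
    have h1 : ∀ x ∈ 𝒯.seed.dom, 𝒯.seed x = γ x := fun x hx => by
      have hxX : x ∈ X := hβ ▸ hseed.1 hx
      rw [γO x (hdisj x hxX (hW x hx)) ⟨hxX, hW x hx, .inl hx, by simp [ht0 x hx]⟩, hseed.2 x hx]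
    refine ⟨fun x hx => ?_, h1⟩
    simp only [dom, Set.mem_ofPred_eq] at hx ⊢
    rwa [← h1 x hx]
  have hγord : 𝒯.IsOrder γ s := by
    intro x hx hxs
    rcases hγdom x hx with hxI | ⟨hxI, hxO⟩
    · refine (ht (x + v) (hβ ▸ hxI.2.1) fun h => hW' _ h hxI.1).trans
        (Finset.sum_le_sum fun d _ => ?_)
      by_cases h0 : t (d.move (x + v)) < t (x + v) ∧ β.bond (x + v) d ≠ 0
      swap
      · rw [not_and_not_right] at h0
        split_ifs with h1 <;> simp [h0, h1]
      obtain ⟨hlt, h0⟩ := h0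
      have hz := (mem_dom_of_bond_ne_zero h0).2
      rw [hβ] at hz
      suffices h : γ (d.move x) = β (d.move (x + v)) ∧ s (d.move x) < s x by
        rw [if_pos hlt, if_pos h.2]
        exact (bond_congr (γI x hxI).symm h.1.symm).le
      by_cases hzW : d.move (x + v) ∈ W'
      · rw [Dir.move_add] at hz hlt hzW ⊢
        have hzI : d.move x ∈ I := ⟨hzW, hz, .inl (hlt.trans_le (hI_le x hxI))⟩
        exact ⟨γI _ hzI, by
          rw [sI _ hzI, sI _ hxI]
          exact lex_lt _ _ _ _ (key'_mono _ _ hlt.le) hlt⟩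
      · obtain ⟨hxB, hzB⟩ := hB' x hxI.1 hxI.2.1 d hz hzW
        rw [Dir.move_add] at hz hlt hzW ⊢
        have hzI : d.move x ∉ I := fun h => hzW h.1
        have hkey : key (d.move x) < key' x := by
          rw [key_eq _ hzB]
          exact key'_lt _ x hxB hlt
        have hzX : d.move x ∈ X := by rwa [hdom, ← htile _ hzB, ← hdom]
        have hzO : d.move x ∈ O := ⟨hzX, fun h => hzW ((hBW _ hzB).1 h),
          .inr (hkey.le.trans (key'_mono _ _ (hI_le x hxI))), Finset.le_sup hzB⟩
        exact ⟨by rw [γO _ hzI hzO, htile _ hzB],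
          by rw [sO _ hzI, sI _ hxI]; exact lex_lt' _ _ _ _ hkey⟩
    · obtain ⟨hxX, hxW, hxk, hxt⟩ := hxO
      have hxk' := hxk.resolve_left hxs
      refine (ht x (hβ ▸ hxX) hxs).trans (Finset.sum_le_sum fun d _ => ?_)
      by_cases h0 : t (d.move x) < t x ∧ β.bond x d ≠ 0
      swap
      · rw [not_and_not_right] at h0
        split_ifs with h1 <;> simp [h0, h1]
      obtain ⟨hlt, h0⟩ := h0
      have hz := (mem_dom_of_bond_ne_zero h0).2
      rw [hβ] at hz
      suffices h : γ (d.move x) = β (d.move x) ∧ s (d.move x) < s x by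
        rw [if_pos hlt, if_pos h.2]
        exact (bond_congr (γO x hxI ⟨hxX, hxW, hxk, hxt⟩).symm h.1.symm).le
      rw [sO x hxI]
      by_cases hzW : d.move x ∈ W
      · obtain ⟨hzB, hxB⟩ := hB _ hzW hz d.opp (by rwa [Dir.move_opp]) (by rwa [Dir.move_opp])
        rw [Dir.move_opp] at hxB
        have hkey : key' (d.move x) < key x := by
          rw [← key_eq _ hzB]
          exact key_lt _ x hxB hlt
        have hzI : d.move x ∈ I := by
          refine ⟨(hBW _ hzB).1 hzW, by rwa [hdom, htile _ hzB, ← hdom], .inl ?_⟩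
          by_contra h
          exact ((key'_mono _ _ (not_lt.1 h)).trans_lt hkey).not_ge hxk'
        exact ⟨by rw [γI _ hzI, htile _ hzB], by rw [sI _ hzI]; exact lex_lt' _ _ _ _ hkey⟩
      · have hzI := hdisj _ hz hzW
        have hk := key_mono _ _ hlt.le
        refine ⟨γO _ hzI ⟨hz, hzW, .inr (hk.trans hxk'), hlt.le.trans hxt⟩, ?_⟩
        rw [sO _ hzI]
        exact lex_lt _ _ _ _ hk hlt
  have heI : e ∈ I := ⟨heW', heX, .inr rfl⟩
  refine heX' (hX γ (hγord.reflTransGen hfin hsub) ?_)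
  have := (hdom _).1 heX
  rwa [← γI e heI] at this

end TAS

/-! ### Blocks of the plane and their faces -/

namespace Dir

/-- The unit vector of a direction. -/
def vec (d : Dir) : ℤ × ℤ := d.move 0

theorem move_eq_add_vec (d : Dir) (p : ℤ × ℤ) : d.move p = p + d.vec := by
  cases d <;> ext <;> simp [move, vec, sub_eq_add_neg]

/-- The coordinate that changes in a direction. -/
def coord : Dir → ℤ × ℤ → ℤ
  | N, p | S, p => p.2
  | E, p | W, p => p.1

/-- The position of the face of a block of side `k` in a direction, relative to the block. -/
def face : Dir → ℤ → ℤ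
  | N, k | E, k => k - 1
  | S, _ | W, _ => 0

theorem coord_add (d : Dir) (p q : ℤ × ℤ) : d.coord (p + q) = d.coord p + d.coord q := by
  cases d <;> rfl

end Dir

/-- The index of the block of side `k` that contains a point. -/
def blockIndex (k : ℤ) (p : ℤ × ℤ) : ℤ × ℤ := (p.1 / k, p.2 / k)

theorem blockIndex_one (p : ℤ × ℤ) : blockIndex 1 p = p := by simp [blockIndex]

theorem blockIndex_mul {i : ℤ} (hi : 0 ≤ i) (j : ℤ) (p : ℤ × ℤ) :
    blockIndex (i * j) p = blockIndex j (blockIndex i p) := by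
  simp [blockIndex, Int.ediv_ediv_of_nonneg hi]

theorem blockIndex_add_smul {k : ℤ} (hk : 0 < k) (p m : ℤ × ℤ) :
    blockIndex k (p + k • m) = blockIndex k p + m := by
  ext <;> simp [blockIndex, Int.add_mul_ediv_left _ _ hk.ne']

theorem blockIndex_of_mem_square {g : ℕ} {p : ℤ × ℤ} (hp : p ∈ square g) :
    blockIndex g p = 0 := by
  obtain ⟨h1, h2, h3, h4⟩ := hp
  simp [blockIndex, Int.ediv_eq_zero_of_lt h1 h2, Int.ediv_eq_zero_of_lt h3 h4]

theorem exists_eq_add_smul_blockIndex {g : ℕ} (hg : 0 < g) (p : ℤ × ℤ) :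
    ∃ a ∈ square g, p = a + (g : ℤ) • blockIndex g p := by
  have hg' : (0 : ℤ) < g := by exact_mod_cast hg
  refine ⟨(p.1 % g, p.2 % g), ⟨Int.emod_nonneg _ hg'.ne', Int.emod_lt_of_pos _ hg',
    Int.emod_nonneg _ hg'.ne', Int.emod_lt_of_pos _ hg'⟩, ?_⟩
  ext <;> simp [blockIndex, Int.emod_add_mul_ediv]

theorem add_one_ediv_eq_iff {k : ℤ} (hk : 0 < k) (x : ℤ) :
    (x + 1) / k = x / k + 1 ↔ x = k * (x / k) + (k - 1) := by
  have h := Int.emod_add_mul_ediv x k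
  have h1 := Int.emod_nonneg x hk.ne'
  have h2 := Int.emod_lt_of_pos x hk
  constructor
  · intro h3
    have h4 := Int.mul_ediv_self_le (x := x + 1) hk.ne'
    rw [h3, mul_add] at h4
    linarith
  · intro h3
    have : x + 1 = 0 + k * (x / k + 1) := by linarith
    rw [this, Int.add_mul_ediv_left _ _ hk.ne']
    simp

theorem sub_one_ediv_eq_iff {k : ℤ} (hk : 0 < k) (x : ℤ) :
    (x - 1) / k = x / k - 1 ↔ x = k * (x / k) + 0 := by
  have h := Int.emod_add_mul_ediv x k
  have h1 := Int.emod_nonneg x hk.ne'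
  constructor
  · intro h3
    have h4 := Int.lt_mul_ediv_self_add (x := x - 1) hk
    rw [h3, mul_sub] at h4
    linarith
  · intro h3
    have : x - 1 = (k - 1) + k * (x / k - 1) := by linarith
    rw [this, Int.add_mul_ediv_left _ _ hk.ne', Int.ediv_eq_zero_of_lt (by linarith) (by linarith)]
    simp

theorem add_one_ediv {k : ℤ} (hk : 0 < k) (x : ℤ) :
    (x + 1) / k = x / k ∨ (x + 1) / k = x / k + 1 := by
  have h1 : x / k ≤ (x + 1) / k := Int.ediv_le_ediv hk (by linarith)
  have h2 : (x + 1) / k ≤ (x + k) / k := Int.ediv_le_ediv hk (by linarith)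
  rw [Int.add_ediv_of_dvd_right dvd_rfl, Int.ediv_self hk.ne'] at h2
  omega

theorem sub_one_ediv {k : ℤ} (hk : 0 < k) (x : ℤ) :
    (x - 1) / k = x / k ∨ (x - 1) / k = x / k - 1 := by
  have := add_one_ediv hk (x - 1)
  rw [sub_add_cancel] at this
  omega

/-- A step either stays in its block or leads to the adjacent block. -/
theorem blockIndex_move {k : ℤ} (hk : 0 < k) (d : Dir) (p : ℤ × ℤ) :
    blockIndex k (d.move p) = blockIndex k p ∨
      blockIndex k (d.move p) = d.move (blockIndex k p) := by
  cases d
  · simpa [blockIndex, Dir.move, Prod.ext_iff] using add_one_ediv hk p.2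
  · simpa [blockIndex, Dir.move, Prod.ext_iff] using add_one_ediv hk p.1
  · simpa [blockIndex, Dir.move, Prod.ext_iff] using sub_one_ediv hk p.2
  · simpa [blockIndex, Dir.move, Prod.ext_iff] using sub_one_ediv hk p.1

/-- The steps that leave a block in a direction are those from the face in that direction. -/
theorem blockIndex_move_eq_iff {k : ℤ} (hk : 0 < k) (d : Dir) (p : ℤ × ℤ) :
    blockIndex k (d.move p) = d.move (blockIndex k p) ↔
      d.coord p = k * d.coord (blockIndex k p) + d.face k := by
  cases d
  · simpa [blockIndex, Dir.move, Dir.coord, Dir.face, Prod.ext_iff] using add_one_ediv_eq_iff hk p.2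
  · simpa [blockIndex, Dir.move, Dir.coord, Dir.face, Prod.ext_iff] using add_one_ediv_eq_iff hk p.1
  · simpa [blockIndex, Dir.move, Dir.coord, Dir.face, Prod.ext_iff] using sub_one_ediv_eq_iff hk p.2
  · simpa [blockIndex, Dir.move, Dir.coord, Dir.face, Prod.ext_iff] using sub_one_ediv_eq_iff hk p.1

/-! ### Bridges of a self-similar set -/

/-- `P` consists of the points all of whose pairs of base `g` digits are in `G`. -/
def IsDigitSet (g : ℕ) (G P : Set (ℤ × ℤ)) : Prop :=
  ∀ a ∈ square g, ∀ m, a + (g : ℤ) • m ∈ P ↔ a ∈ G ∧ m ∈ P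

/-- `a` is the end in direction `d` of a bridge of `G`: the point reached from `a` by a step in
direction `d`, modulo `g`, is also in `G`. -/
def IsBridgeEnd (g : ℕ) (G : Set (ℤ × ℤ)) (d : Dir) (a : ℤ × ℤ) : Prop :=
  a ∈ G ∧ a + (1 - (g : ℤ)) • d.vec ∈ G

theorem move_add_smul (g : ℤ) (d : Dir) (a m : ℤ × ℤ) :
    d.move (a + g • m) = (a + (1 - g) • d.vec) + g • d.move m := by
  simp only [Dir.move_eq_add_vec, sub_smul, one_smul, smul_add]
  abel

/-- A step from a point of the square leads out of it iff the point reached, reduced modulo `g`, is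
`a + (1 - g) • d.vec`. -/
theorem add_smul_vec_mem_square_iff {g : ℕ} {a : ℤ × ℤ} (ha : a ∈ square g) (d : Dir) :
    a + (1 - (g : ℤ)) • d.vec ∈ square g ↔ d.move a ∉ square g := by
  simp only [square, Set.mem_ofPred_eq] at ha
  cases d <;> simp [square, Dir.move, Dir.vec] <;> omega

section

variable {g : ℕ} {G P : Set (ℤ × ℤ)}

theorem IsDigitSet.mem_iff (hP : IsDigitSet g G P) (hg : 0 < g) (p : ℤ × ℤ) :
    p ∈ P ↔ p - (g : ℤ) • blockIndex g p ∈ G ∧ blockIndex g p ∈ P := by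
  obtain ⟨a, ha, h⟩ := exists_eq_add_smul_blockIndex hg p
  have h' := hP a ha (blockIndex g p)
  rw [← h] at h'
  rw [h', sub_eq_of_eq_add h]

theorem IsDigitSet.blockIndex_pow_mem (hP : IsDigitSet g G P) (hg : 0 < g) (s : ℕ) {p : ℤ × ℤ}
    (hp : p ∈ P) : blockIndex ((g : ℤ) ^ s) p ∈ P := by
  induction s generalizing p with
  | zero => simpa [blockIndex_one] using hp
  | succ s ih =>
    rw [pow_succ', blockIndex_mul (by positivity)]
    exact ih ((hP.mem_iff hg p).1 hp).2

/-- The point `b` is the end in direction `d` of a bridge from the block `m` of side `k` to the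
adjacent block. -/
def IsCrossing (P : Set (ℤ × ℤ)) (k : ℤ) (d : Dir) (m b : ℤ × ℤ) : Prop :=
  b ∈ P ∧ d.move b ∈ P ∧ blockIndex k b = m ∧ blockIndex k (d.move b) = d.move m

theorem existsUnique_isCrossing_one_level (hg : 0 < g) (hG : G ⊆ square g)
    (hP : IsDigitSet g G P) {d : Dir} (hbr : ∃! a, IsBridgeEnd g G d a) {m : ℤ × ℤ} (hm : m ∈ P)
    (hm' : d.move m ∈ P) : ∃! b, IsCrossing P g d m b := by
  have hg' : (0 : ℤ) < g := by exact_mod_cast hg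
  obtain ⟨a, ha, huniq⟩ := hbr
  refine ⟨a + (g : ℤ) • m, ⟨(hP a (hG ha.1) m).2 ⟨ha.1, hm⟩, ?_, ?_, ?_⟩, ?_⟩
  · rw [move_add_smul]
    exact (hP _ (hG ha.2) _).2 ⟨ha.2, hm'⟩
  · rw [blockIndex_add_smul hg', blockIndex_of_mem_square (hG ha.1), zero_add]
  · rw [move_add_smul, blockIndex_add_smul hg', blockIndex_of_mem_square (hG ha.2), zero_add]
  · rintro b ⟨hb, hb', h1, h2⟩
    obtain ⟨a', ha', h⟩ := exists_eq_add_smul_blockIndex hg b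
    rw [h1] at h
    subst h
    rw [move_add_smul] at hb' h2
    have hsq : a' + (1 - (g : ℤ)) • d.vec ∈ square g := by
      rw [add_smul_vec_mem_square_iff ha']
      intro h3
      rw [← move_add_smul, Dir.move_eq_add_vec, add_right_comm, ← Dir.move_eq_add_vec,
        blockIndex_add_smul hg', blockIndex_of_mem_square h3, zero_add] at h2
      exact d.move_ne m h2.symm
    rw [huniq a' ⟨((hP a' ha' m).1 hb).1, ((hP _ hsq _).1 hb').1⟩]

/-- Adjacent blocks of side `g ^ s` that meet `P` are joined by exactly one bridge. -/
theorem existsUnique_isCrossing (hg : 0 < g) (hG : G ⊆ square g)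
    (hP : IsDigitSet g G P) {d : Dir} (hbr : ∃! a, IsBridgeEnd g G d a) (s : ℕ) {m : ℤ × ℤ}
    (hm : m ∈ P) (hm' : d.move m ∈ P) : ∃! b, IsCrossing P ((g : ℤ) ^ s) d m b := by
  have hg' : (0 : ℤ) < g := by exact_mod_cast hg
  induction s with
  | zero =>
    refine ⟨m, ⟨hm, hm', ?_⟩, fun b hb => ?_⟩
    · simp [blockIndex_one]
    · simpa [blockIndex_one] using hb.2.2.1
  | succ s ih =>
    obtain ⟨b₁, hb₁, huniq⟩ := ih
    obtain ⟨b, hb, huniq'⟩ := existsUnique_isCrossing_one_level hg hG hP hbr hb₁.1 hb₁.2.1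
    simp only [IsCrossing, pow_succ', blockIndex_mul hg'.le]
    refine ⟨b, ⟨hb.1, hb.2.1, ?_, ?_⟩, ?_⟩
    · rw [hb.2.2.1, hb₁.2.2.1]
    · rw [hb.2.2.2, hb₁.2.2.2]
    · rintro y ⟨hy, hy', h1, h2⟩
      have h3 : blockIndex g (d.move y) = d.move (blockIndex g y) := by
        refine (blockIndex_move hg' d y).resolve_left fun h => ?_
        rw [h, h1] at h2
        exact d.move_ne m h2.symm
      have h4 := ((hP.mem_iff hg _).1 hy').2
      rw [h3] at h2 h4
      have h5 := huniq _ ⟨((hP.mem_iff hg _).1 hy).2, h4, h1, h2⟩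
      exact huniq' y ⟨hy, hy', h5, by rw [h3, h5]⟩

/-- Each column of a block of side `g ^ s` that meets `P` contains a point of `P`. -/
theorem IsDigitSet.exists_mem_column (hP : IsDigitSet g G P) (hg : 0 < g) (hG : G ⊆ square g)
    (hcol : ∀ x : ℤ, 0 ≤ x → x < g → ∃ y, (x, y) ∈ G) (s : ℕ) {m : ℤ × ℤ} (hm : m ∈ P) {x : ℤ}
    (hx : x / (g : ℤ) ^ s = m.1) : ∃ y, (x, y) ∈ P ∧ blockIndex ((g : ℤ) ^ s) (x, y) = m := by
  have hg' : (0 : ℤ) < g := by exact_mod_cast hg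
  induction s generalizing x with
  | zero =>
    obtain rfl : x = m.1 := by simpa using hx
    exact ⟨m.2, hm, by simp [blockIndex_one]⟩
  | succ s ih =>
    rw [pow_succ', ← Int.ediv_ediv_of_nonneg hg'.le] at hx
    obtain ⟨y, hy, hy'⟩ := ih hx
    obtain ⟨z, hz⟩ := hcol _ (Int.emod_nonneg x hg'.ne') (Int.emod_lt_of_pos x hg')
    have h : ((x, z + g * y) : ℤ × ℤ) = (x % g, z) + (g : ℤ) • (x / g, y) := by
      ext <;> simp [Int.emod_add_mul_ediv]
    refine ⟨z + g * y, ?_, ?_⟩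
    · rw [h]
      exact (hP _ (hG hz) _).2 ⟨hz, hy⟩
    · rw [pow_succ', blockIndex_mul hg'.le, h, blockIndex_add_smul hg',
        blockIndex_of_mem_square (hG hz), zero_add, hy']

end

section

variable {g : ℕ} {G P : Set (ℤ × ℤ)}

/-! ### Pier fractals -/

theorem IsGenerator.pos (hG : IsGenerator g G) : 0 < g := zero_lt_one.trans hG.one_lt

theorem IsGenerator.zero_mem (hG : IsGenerator g G) : (0 : ℤ × ℤ) ∈ G :=
  hG.origin_ssubset.subset rfl

theorem IsGenerator.sInf_sSup_fst (hG : IsGenerator g G) :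
    sInf (Prod.fst '' G) = 0 ∧ sSup (Prod.fst '' G) = (g : ℤ) - 1 := by
  have hg := hG.one_lt
  constructor
  · refine IsLeast.csInf_eq ⟨⟨0, hG.zero_mem, rfl⟩, ?_⟩
    rintro _ ⟨p, hp, rfl⟩
    exact (hG.ssubset_square.subset hp).1
  · obtain ⟨y, hy⟩ := hG.column (g - 1) (by omega) (by omega)
    refine IsGreatest.csSup_eq ⟨⟨_, hy, rfl⟩, ?_⟩
    rintro _ ⟨p, hp, rfl⟩
    exact Int.le_sub_one_of_lt (hG.ssubset_square.subset hp).2.1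

theorem IsGenerator.sInf_sSup_snd (hG : IsGenerator g G) :
    sInf (Prod.snd '' G) = 0 ∧ sSup (Prod.snd '' G) = (g : ℤ) - 1 := by
  have hg := hG.one_lt
  constructor
  · refine IsLeast.csInf_eq ⟨⟨0, hG.zero_mem, rfl⟩, ?_⟩
    rintro _ ⟨p, hp, rfl⟩
    exact (hG.ssubset_square.subset hp).2.2.1
  · obtain ⟨x, hx⟩ := hG.row (g - 1) (by omega) (by omega)
    refine IsGreatest.csSup_eq ⟨⟨_, hx, rfl⟩, ?_⟩
    rintro _ ⟨p, hp, rfl⟩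
    exact Int.le_sub_one_of_lt (hG.ssubset_square.subset hp).2.2.2

theorem IsGenerator.existsUnique_hbridge (hG : IsGenerator g G) (h : nhb G = 1) :
    ∃! y : ℤ, ((0 : ℤ), y) ∈ G ∧ ((g : ℤ) - 1, y) ∈ G := by
  unfold nhb at h
  rw [hG.sInf_sSup_fst.1, hG.sInf_sSup_fst.2, Set.ncard_eq_one] at h
  obtain ⟨B, hB⟩ := h
  obtain ⟨hBG, y, rfl⟩ : B ∈ {B : Set (ℤ × ℤ) | B ⊆ G ∧
    ∃ y : ℤ, B = {((0 : ℤ), y), ((g : ℤ) - 1, y)}} := hB ▸ rfl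
  refine ⟨y, ⟨hBG (by simp), hBG (by simp)⟩, fun z hz => ?_⟩
  have hz' : ({((0 : ℤ), z), ((g : ℤ) - 1, z)} : Set (ℤ × ℤ)) ∈ {B : Set (ℤ × ℤ) | B ⊆ G ∧
    ∃ y : ℤ, B = {((0 : ℤ), y), ((g : ℤ) - 1, y)}} :=
    ⟨Set.insert_subset hz.1 (Set.singleton_subset_iff.2 hz.2), z, rfl⟩
  rw [hB] at hz'
  have : ((0 : ℤ), z) ∈ ({((0 : ℤ), y), ((g : ℤ) - 1, y)} : Set (ℤ × ℤ)) :=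
    Set.mem_singleton_iff.1 hz' ▸ Set.mem_insert _ _
  rcases this with h | h <;> exact (Prod.ext_iff.1 h).2

theorem IsGenerator.existsUnique_vbridge (hG : IsGenerator g G) (h : nvb G = 1) :
    ∃! x : ℤ, (x, (0 : ℤ)) ∈ G ∧ (x, (g : ℤ) - 1) ∈ G := by
  unfold nvb at h
  rw [hG.sInf_sSup_snd.1, hG.sInf_sSup_snd.2, Set.ncard_eq_one] at h
  obtain ⟨B, hB⟩ := h
  obtain ⟨hBG, x, rfl⟩ : B ∈ {B : Set (ℤ × ℤ) | B ⊆ G ∧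
    ∃ x : ℤ, B = {(x, (0 : ℤ)), (x, (g : ℤ) - 1)}} := hB ▸ rfl
  refine ⟨x, ⟨hBG (by simp), hBG (by simp)⟩, fun z hz => ?_⟩
  have hz' : ({(z, (0 : ℤ)), (z, (g : ℤ) - 1)} : Set (ℤ × ℤ)) ∈ {B : Set (ℤ × ℤ) | B ⊆ G ∧
    ∃ x : ℤ, B = {(x, (0 : ℤ)), (x, (g : ℤ) - 1)}} :=
    ⟨Set.insert_subset hz.1 (Set.singleton_subset_iff.2 hz.2), z, rfl⟩
  rw [hB] at hz'
  have : (z, (0 : ℤ)) ∈ ({(x, (0 : ℤ)), (x, (g : ℤ) - 1)} : Set (ℤ × ℤ)) :=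
    Set.mem_singleton_iff.1 hz' ▸ Set.mem_insert _ _
  rcases this with h | h <;> exact (Prod.ext_iff.1 h).1

theorem IsGenerator.existsUnique_isBridgeEnd (hG : IsGenerator g G) (hh : nhb G = 1)
    (hv : nvb G = 1) (d : Dir) : ∃! a, IsBridgeEnd g G d a := by
  obtain ⟨y, ⟨hy, hy'⟩, hyu⟩ := hG.existsUnique_hbridge hh
  obtain ⟨x, ⟨hx, hx'⟩, hxu⟩ := hG.existsUnique_vbridge hv
  have hsq : ∀ p : ℤ × ℤ, p ∈ G → 0 ≤ p.1 ∧ p.1 < g ∧ 0 ≤ p.2 ∧ p.2 < g :=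
    fun p hp => hG.ssubset_square.subset hp
  cases d
  · refine ⟨(x, g - 1), ⟨hx', ?_⟩, ?_⟩
    · convert hx using 1
      simp [Dir.move, Dir.vec]
    · rintro ⟨a, b⟩ ⟨h1, h2⟩
      have h3 := hsq _ h1
      have h4 := hsq _ h2
      simp [Dir.move, Dir.vec] at h2 h3 h4
      obtain rfl : b = g - 1 := by omega
      rw [hxu a ⟨by simpa using h2, h1⟩]
  · refine ⟨(g - 1, y), ⟨hy', ?_⟩, ?_⟩
    · convert hy using 1
      simp [Dir.move, Dir.vec]
    · rintro ⟨a, b⟩ ⟨h1, h2⟩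
      have h3 := hsq _ h1
      have h4 := hsq _ h2
      simp [Dir.move, Dir.vec] at h2 h3 h4
      obtain rfl : a = g - 1 := by omega
      rw [hyu b ⟨by simpa using h2, h1⟩]
  · refine ⟨(x, 0), ⟨hx, ?_⟩, ?_⟩
    · convert hx' using 1
      simp [Dir.move, Dir.vec]
    · rintro ⟨a, b⟩ ⟨h1, h2⟩
      have h3 := hsq _ h1
      have h4 := hsq _ h2
      simp [Dir.move, Dir.vec] at h2 h3 h4
      obtain rfl : b = 0 := by omega
      rw [hxu a ⟨h1, by simpa using h2⟩]
  · refine ⟨(0, y), ⟨hy, ?_⟩, ?_⟩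
    · convert hy' using 1
      simp [Dir.move, Dir.vec]
    · rintro ⟨a, b⟩ ⟨h1, h2⟩
      have h3 := hsq _ h1
      have h4 := hsq _ h2
      simp [Dir.move, Dir.vec] at h2 h3 h4
      obtain rfl : a = 0 := by omega
      rw [hyu b ⟨h1, by simpa using h2⟩]

/-- The stages can also be built by adding the least significant digit. -/
theorem mem_stage_succ_iff (i : ℕ) (p : ℤ × ℤ) :
    p ∈ stage g G (i + 1) ↔ ∃ a ∈ G, ∃ m ∈ stage g G i, p = a + (g : ℤ) • m := by
  induction i generalizing p with
  | zero => simp [stage]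
  | succ i ih =>
    constructor
    · rintro ⟨m, hm, n, hn, rfl⟩
      obtain ⟨a, ha, m', hm', rfl⟩ := (ih m).1 hm
      exact ⟨a, ha, _, ⟨m', hm', n, hn, rfl⟩, by rw [smul_add, smul_smul, ← pow_succ', ← add_assoc]⟩
    · rintro ⟨a, ha, _, ⟨m', hm', n, hn, rfl⟩, rfl⟩
      exact ⟨_, (ih _).2 ⟨a, ha, m', hm', rfl⟩, n, hn,
        by rw [smul_add, smul_smul, ← pow_succ', ← add_assoc]⟩

theorem IsGenerator.isDigitSet (hG : IsGenerator g G) : IsDigitSet g G (selfSimilarSet g G) := by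
  have hg' : (0 : ℤ) < g := by exact_mod_cast hG.pos
  have hsub : ∀ i, stage g G i ⊆ stage g G (i + 1) := fun i p hp =>
    ⟨p, hp, 0, hG.zero_mem, by simp⟩
  intro a ha m
  simp only [selfSimilarSet, Set.mem_iUnion]
  constructor
  · rintro ⟨i, hi⟩
    obtain ⟨b, hb, n, hn, h⟩ := (mem_stage_succ_iff i _).1 (hsub i hi)
    have h' := congrArg (blockIndex g) h
    rw [blockIndex_add_smul hg', blockIndex_add_smul hg', blockIndex_of_mem_square ha,
      blockIndex_of_mem_square (hG.ssubset_square.subset hb), zero_add, zero_add] at h'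
    subst h'
    rw [add_left_inj] at h
    exact ⟨h ▸ hb, i, hn⟩
  · rintro ⟨haG, i, hi⟩
    exact ⟨i + 1, (mem_stage_succ_iff i _).2 ⟨a, haG, m, hi, rfl⟩⟩

theorem IsGenerator.nonneg_of_mem (hG : IsGenerator g G) {p : ℤ × ℤ}
    (hp : p ∈ selfSimilarSet g G) : 0 ≤ p.1 ∧ 0 ≤ p.2 := by
  obtain ⟨i, hi⟩ := Set.mem_iUnion.1 hp
  clear hp
  induction i generalizing p with
  | zero =>
    have := hG.ssubset_square.subset hi
    exact ⟨this.1, this.2.2.1⟩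
  | succ i ih =>
    obtain ⟨a, ha, m, hm, rfl⟩ := (mem_stage_succ_iff i p).1 hi
    have h := hG.ssubset_square.subset ha
    have h1 := h.1
    have h2 := h.2.2.1
    have h3 := ih hm
    simp only [Prod.fst_add, Prod.snd_add, Prod.smul_fst, Prod.smul_snd, smul_eq_mul]
    have := h3.1
    have := h3.2
    constructor <;> positivity

theorem IsPier.existsUnique_move_mem {p : ℤ × ℤ} (hp : IsPier G p) : ∃! d : Dir, d.move p ∈ G := by
  classical
  have h1 : ({d : Dir | d.move p ∉ G}ᶜ).ncard = 1 := by
    have h := Set.ncard_add_ncard_compl {d : Dir | d.move p ∉ G}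
    have h4 : Nat.card Dir = 4 := by rw [Nat.card_eq_fintype_card]; rfl
    rw [hp.2, h4] at h
    omega
  obtain ⟨d, hd⟩ := Set.ncard_eq_one.1 h1
  have hiff : ∀ d', d'.move p ∈ G ↔ d' = d := fun d' => by
    rw [← Set.mem_singleton_iff, ← hd]
    simp
  exact ⟨d, (hiff d).2 rfl, fun d' hd' => (hiff d').1 hd'⟩

/-- A step from `a + g m` in a direction in which `a` is free in `G` leads into `P` only over a
bridge. -/
theorem move_add_smul_mem_iff (hG : G ⊆ square g) (hP : IsDigitSet g G P) {a m : ℤ × ℤ}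
    (ha : a ∈ G) {d : Dir} (hd : d.move a ∉ G) :
    d.move (a + (g : ℤ) • m) ∈ P ↔ IsBridgeEnd g G d a ∧ d.move m ∈ P := by
  by_cases h : d.move a ∈ square g
  · have h' := mt (fun h' : IsBridgeEnd g G d a =>
      (add_smul_vec_mem_square_iff (hG ha) d).1 (hG h'.2)) (not_not.2 h)
    rw [Dir.move_eq_add_vec, add_right_comm, ← Dir.move_eq_add_vec, hP _ h]
    tauto
  · rw [move_add_smul, hP _ ((add_smul_vec_mem_square_iff (hG ha) d).2 h)]
    exact ⟨fun h' => ⟨⟨ha, h'.1⟩, h'.2⟩, fun h' => ⟨h'.1.2, h'.2⟩⟩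

/-- Each direction has a point of `G` that is free in that direction in every copy of `G`:
the last point of a row or column off the bridge. -/
theorem IsGenerator.exists_free (hG : IsGenerator g G) (d : Dir) {b : ℤ × ℤ}
    (hb : IsBridgeEnd g G d b) (hbr : ∀ a, IsBridgeEnd g G d a → a = b) :
    ∃ n ∈ G, n ≠ b ∧ d.move n ∉ G := by
  have hg := hG.one_lt
  obtain ⟨n, hn, hnb⟩ : ∃ n ∈ G, ∀ k : ℤ, n + k • d.vec ≠ b := by
    cases d
    case N | S =>
      obtain ⟨y, hy⟩ := hG.column (if b.1 = 0 then 1 else 0) (by split_ifs <;> omega)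
        (by split_ifs <;> omega)
      refine ⟨_, hy, fun k hk => ?_⟩
      have := congrArg Prod.fst hk
      simp [Dir.vec, Dir.move] at this
      split_ifs at this <;> omega
    case E | W =>
      obtain ⟨x, hx⟩ := hG.row (if b.2 = 0 then 1 else 0) (by split_ifs <;> omega)
        (by split_ifs <;> omega)
      refine ⟨_, hx, fun k hk => ?_⟩
      have := congrArg Prod.snd hk
      simp [Dir.vec, Dir.move] at this
      split_ifs at this <;> omega
  -- otherwise the walk from `n` in direction `d` stays in `G` forever
  by_contra! hno
  have hall : ∀ k : ℕ, n + (k : ℤ) • d.vec ∈ G := fun k => by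
    induction k with
    | zero => simpa using hn
    | succ k ih =>
      have := hno _ ih (hnb k)
      rw [Dir.move_eq_add_vec, add_assoc] at this
      convert this using 2
      push_cast
      rw [add_smul, one_smul]
  have h0 := hG.ssubset_square.subset (hall 0)
  have h1 := hG.ssubset_square.subset (hall g)
  simp only [square, Set.mem_ofPred_eq] at h0 h1
  cases d <;> simp [Dir.vec, Dir.move] at h0 h1 <;> omega

/-- If a pier is the end of two bridges, it is a corner of the square; the line of `G` through it
along which it has no neighbour contains another point that is free in both directions. -/
theorem IsGenerator.exists_free_of_corner (hG : IsGenerator g G) {d₁ d₂ : Dir} {p : ℤ × ℤ}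
    (h₁ : IsBridgeEnd g G d₁ p) (h₂ : IsBridgeEnd g G d₂ p) (hne : d₁ ≠ d₂) (hne' : d₁ ≠ d₂.opp)
    (hp : d₂.opp.move p ∉ G) : ∃ n ∈ G, n ≠ p ∧ d₁.move n ∉ G ∧ d₂.move n ∉ G := by
  have hg := hG.one_lt
  have hsq₁ := hG.ssubset_square.subset h₁.1
  have hsq₂ := hG.ssubset_square.subset h₁.2
  -- walk from the other end of the bridge towards `p` until the next point is not in `G`
  obtain ⟨k, ⟨hkg, hk⟩, hk'⟩ : ∃ k : ℕ, (k + 2 ≤ g ∧ p + (1 - (g : ℤ) + k) • d₂.vec ∈ G) ∧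
      ¬ (k + 1 + 2 ≤ g ∧ p + (1 - (g : ℤ) + (k + 1 : ℕ)) • d₂.vec ∈ G) := by
    by_contra! hno
    have hall : ∀ k : ℕ, k + 2 ≤ g ∧ p + (1 - (g : ℤ) + k) • d₂.vec ∈ G := fun k => by
      induction k with
      | zero => exact ⟨hg, by simpa using h₂.2⟩
      | succ k ih => exact hno k ih
    have := (hall g).1
    omega
  have hkg' : k + 1 + 2 ≤ g := by
    by_contra hc
    have : (1 : ℤ) - g + k = -1 := by omega
    refine hp ?_
    rw [this] at hk
    convert hk using 1
    cases d₂ <;> simp [Dir.move, Dir.opp, Dir.vec, Prod.ext_iff, sub_eq_add_neg]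
  refine ⟨_, hk, fun h => ?_, fun h => ?_, fun h => hk' ⟨hkg', ?_⟩⟩
  · have h0 : (1 - (g : ℤ) + k) • d₂.vec = 0 := by simpa using h
    cases d₂ <;> simp [Dir.vec, Dir.move, Prod.ext_iff] at h0 <;> omega
  · have h3 := hG.ssubset_square.subset h
    simp only [square, Set.mem_ofPred_eq] at hsq₁ hsq₂ h3
    cases d₁ <;> cases d₂ <;> simp [Dir.vec, Dir.move, Dir.opp] at hne hne' hsq₁ hsq₂ h3 <;> omega
  · rw [Dir.move_eq_add_vec, add_assoc] at h
    convert h using 2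
    push_cast
    rw [← add_assoc, add_smul _ 1, one_smul]

theorem not_isBridgeEnd_opp (hG : G ⊆ square g) (hg : 1 < g) {d : Dir} {p : ℤ × ℤ}
    (h : IsBridgeEnd g G d p) : ¬ IsBridgeEnd g G d.opp p := by
  intro h'
  have h1 := hG h.2
  have h2 := hG h'.2
  have h3 := hG h.1
  simp only [square, Set.mem_ofPred_eq] at h1 h2 h3
  cases d <;> simp [Dir.vec, Dir.move, Dir.opp] at h1 h2 h3 <;> omega

/-- Some point of `G` is free in `P` in each direction in which a bridge ends at the pier `p`. -/
theorem IsGenerator.exists_free_of_isPier (hG : IsGenerator g G)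
    (hbr : ∀ d, ∃! a, IsBridgeEnd g G d a) {p : ℤ × ℤ} (hp : IsPier G p) :
    ∃ n ∈ G, ∀ d, IsBridgeEnd g G d p → n ≠ p ∧ d.move n ∉ G := by
  have hGs := hG.ssubset_square.subset
  by_cases h₁ : ∃ d₁, IsBridgeEnd g G d₁ p
  swap
  · exact ⟨p, hp.1, fun d hd => absurd ⟨d, hd⟩ h₁⟩
  obtain ⟨d₁, h₁⟩ := h₁
  by_cases h₂ : ∃ d₂, d₁ ≠ d₂ ∧ IsBridgeEnd g G d₂ p
  · obtain ⟨d₂, hne, h₂⟩ := h₂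
    have hopp : ∀ d d', IsBridgeEnd g G d p → IsBridgeEnd g G d' p → d ≠ d'.opp := by
      rintro _ d' h h' rfl
      exact not_isBridgeEnd_opp hGs hG.one_lt h' h
    have hall : ∀ d, IsBridgeEnd g G d p → d = d₁ ∨ d = d₂ := fun d hd => by
      have h3 := hopp d d₁ hd h₁
      have h4 := hopp d d₂ hd h₂
      have h5 := hopp d₁ d₂ h₁ h₂
      revert hne h3 h4 h5
      cases d <;> cases d₁ <;> cases d₂ <;> simp [Dir.opp]
    suffices ∃ n ∈ G, n ≠ p ∧ d₁.move n ∉ G ∧ d₂.move n ∉ G by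
      obtain ⟨n, hn, hnp, h3, h4⟩ := this
      refine ⟨n, hn, fun d hd => ⟨hnp, ?_⟩⟩
      rcases hall d hd with rfl | rfl <;> assumption
    obtain ⟨d₀, hd₀, hu⟩ := hp.existsUnique_move_mem
    by_cases h : d₂.opp.move p ∈ G
    · have h' : d₁.opp.move p ∉ G := fun h' => hne <| by
        have := (hu _ h).trans (hu _ h').symm
        simpa using (congrArg Dir.opp this).symm
      obtain ⟨n, hn, hnp, h3, h4⟩ :=
        hG.exists_free_of_corner h₂ h₁ hne.symm (hopp _ _ h₂ h₁) h'
      exact ⟨n, hn, hnp, h4, h3⟩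
    · exact hG.exists_free_of_corner h₁ h₂ hne (hopp _ _ h₁ h₂) h
  · have hall : ∀ d, IsBridgeEnd g G d p → d₁ = d := fun d hd => by
      by_contra hne
      exact h₂ ⟨d, hne, hd⟩
    obtain ⟨n, hn, h⟩ := hG.exists_free d₁ h₁ fun a ha => (hbr d₁).unique ha h₁
    exact ⟨n, hn, fun d hd => hall d hd ▸ h⟩

/-- A pier fractal has a point other than the origin with exactly one neighbour in the fractal. -/
theorem IsGenerator.exists_existsUnique_move_mem (hG : IsGenerator g G)
    (hbr : ∀ d, ∃! a, IsBridgeEnd g G d a) {p : ℤ × ℤ} (hp : IsPier G p) :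
    ∃ q ∈ selfSimilarSet g G, q ≠ 0 ∧ ∃! d : Dir, d.move q ∈ selfSimilarSet g G := by
  have hg' : (0 : ℤ) < g := by exact_mod_cast hG.pos
  have hGs := hG.ssubset_square.subset
  have hP := hG.isDigitSet
  obtain ⟨n, hn, hfree⟩ := hG.exists_free_of_isPier hbr hp
  obtain ⟨d, hd, hu⟩ := hp.existsUnique_move_mem
  obtain ⟨n', hn', hne⟩ := Set.exists_of_ssubset hG.origin_ssubset
  have hm : n + (g : ℤ) • n' ∈ selfSimilarSet g G :=
    (hP n (hGs hn) n').2 ⟨hn, Set.mem_iUnion.2 ⟨0, hn'⟩⟩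
  refine ⟨p + (g : ℤ) • (n + (g : ℤ) • n'), (hP p (hGs hp.1) _).2 ⟨hp.1, hm⟩, fun h => hne ?_, d,
    ?_, fun d' hd' => ?_⟩
  · have h := congrArg (fun x => blockIndex g (blockIndex g x)) h
    simp only [blockIndex_add_smul hg', blockIndex_of_mem_square (hGs hn),
      blockIndex_of_mem_square (hGs hp.1), zero_add] at h
    rw [h]
    simp [blockIndex]
  · change d.move _ ∈ _
    rw [Dir.move_eq_add_vec, add_right_comm, ← Dir.move_eq_add_vec]
    exact (hP _ (hGs hd) _).2 ⟨hd, hm⟩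
  · refine hu d' (by_contra fun hd'' => ?_)
    obtain ⟨h1, h2⟩ := (move_add_smul_mem_iff hGs hP hp.1 hd'').1 hd'
    obtain ⟨hnp, hfr⟩ := hfree d' h1
    exact hnp ((hbr d').unique ((move_add_smul_mem_iff hGs hP hn hfr).1 h2).1 h1)

end

/-! ### Scaled pier fractals -/

theorem finite_blockIndex_eq {c : ℕ} (hc : 0 < c) (m : ℤ × ℤ) :
    {x | blockIndex c x = m}.Finite := by
  refine ((Set.finite_Icc ((0, 0) : ℤ × ℤ) (c, c)).image (· + (c : ℤ) • m)).subset ?_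
  rintro x rfl
  obtain ⟨a, ⟨h1, h2, h3, h4⟩, h⟩ := exists_eq_add_smul_blockIndex hc x
  exact ⟨a, ⟨⟨h1, h3⟩, h2.le, h4.le⟩, h.symm⟩

/-- If `d` is the only direction from `q` within `P`, then a step between points of the scaling of
`P` that leaves the block `q` of side `k` leads in direction `d` to the next block. -/
theorem eq_of_leaves_block {P : Set (ℤ × ℤ)} {k c : ℤ} (hk : 0 < k) (hc : 0 < c)
    (hPk : ∀ p ∈ P, blockIndex k p ∈ P) {q : ℤ × ℤ} {d : Dir} (hd : ∀ d', d'.move q ∈ P → d' = d)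
    {x : ℤ × ℤ} {d' : Dir} (hx : blockIndex k (blockIndex c x) = q)
    (hxP : blockIndex c (d'.move x) ∈ P) (hx' : blockIndex k (blockIndex c (d'.move x)) ≠ q) :
    d' = d ∧ blockIndex c (d.move x) = d.move (blockIndex c x) ∧
      blockIndex k (d.move (blockIndex c x)) = d.move q := by
  have h1 : blockIndex c (d'.move x) = d'.move (blockIndex c x) :=
    (blockIndex_move hc d' x).resolve_left fun h => hx' (h ▸ hx)
  rw [h1] at hx'
  have h2 : blockIndex k (d'.move (blockIndex c x)) = d'.move q :=
    hx ▸ (blockIndex_move hk d' (blockIndex c x)).resolve_left fun h => hx' (h.trans hx)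
  obtain rfl := hd d' (h2 ▸ hPk _ (h1 ▸ hxP))
  exact ⟨rfl, h1, h2⟩

theorem le_of_one_le_ediv_ediv {c k : ℤ} (hc : 0 < c) (hk : 0 < k) {x : ℤ} (h : 1 ≤ x / c / k) :
    k ≤ x := by
  rw [Int.le_ediv_iff_mul_le hk, Int.le_ediv_iff_mul_le hc] at h
  nlinarith

/-- The windows of `TAS.false_of_windows` are the scaled blocks `q` of two sides `g ^ s`, where `q` has
a single neighbour in the fractal; the two sides are found by the pigeonhole principle: there are finitely many
possibilities for the tiles at the `2 c ^ 2` points of the scaled bridge and the order of their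
attachment. The translation aligns the bridges, hence the faces that they cross. -/
theorem IsGenerator.not_strictlySelfAssembles {Sym : Type*} {g : ℕ} {G : Set (ℤ × ℤ)}
    (hG : IsGenerator g G) (hbr : ∀ d, ∃! a, IsBridgeEnd g G d a) {p : ℤ × ℤ} (hp : IsPier G p)
    {c : ℕ} (hc : 0 < c) (𝒯 : TAS Sym) :
    ¬ 𝒯.StrictlySelfAssembles (scaling c (selfSimilarSet g G)) := by
  classical
  intro hX
  have hc' : (0 : ℤ) < c := by exact_mod_cast hc
  have hg' : (0 : ℤ) < g := by exact_mod_cast hG.pos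
  have hP := hG.isDigitSet
  have hGs := hG.ssubset_square.subset
  obtain ⟨β, hβ, hβ'⟩ := TAS.exists_produces_isTerminal 𝒯.seed_isAssembly 𝒯.seed_stable
  have hβX := hX β hβ hβ'
  obtain ⟨t, ht, ht0, htfin⟩ := hβ.exists_isOrder
  obtain ⟨q, hq, hq0, d, hd, hu⟩ := hG.exists_existsUnique_move_mem hbr hp
  have hnonneg := hG.nonneg_of_mem hq
  set P := selfSimilarSet g G
  have hk : ∀ s : ℕ, (0 : ℤ) < (g : ℤ) ^ s := fun s => by positivity
  -- the only bridge between the block `q` of side `g ^ s` and the rest of `P`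
  choose b hb hbu using fun s => existsUnique_isCrossing hG.pos hGs hP (hbr d) s hq hd
  let W : ℕ → Set (ℤ × ℤ) := fun s => {x | blockIndex ((g : ℤ) ^ s) (blockIndex c x) = q}
  -- the seed is outside all large blocks
  obtain ⟨N, hN⟩ : ∃ N : ℕ, ∀ s ≥ N, ∀ x ∈ 𝒯.seed.dom, x ∉ W s := by
    obtain ⟨N₁, hN₁⟩ := (𝒯.seed_finite.image fun x => x.1.toNat).bddAbove
    obtain ⟨N₂, hN₂⟩ := (𝒯.seed_finite.image fun x => x.2.toNat).bddAbove
    refine ⟨max N₁ N₂, fun s hs x hx hxW => ?_⟩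
    have h1 : x.1.toNat ≤ N₁ := hN₁ ⟨x, hx, rfl⟩
    have h2 : x.2.toNat ≤ N₂ := hN₂ ⟨x, hx, rfl⟩
    have h3 : (s : ℤ) < (g : ℤ) ^ s := by exact_mod_cast Nat.lt_pow_self hG.one_lt
    have hq' : 1 ≤ q.1 ∨ 1 ≤ q.2 := by
      by_contra! h
      exact hq0 (Prod.ext (by simp; omega) (by simp; omega))
    have hxW' : blockIndex ((g : ℤ) ^ s) (blockIndex c x) = q := hxW
    rcases hq' with h | h
    · rw [← hxW'] at h
      have := le_of_one_le_ediv_ediv hc' (hk s) h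
      omega
    · rw [← hxW'] at h
      have := le_of_one_le_ediv_ediv hc' (hk s) h
      omega
  -- two blocks at whose bridges the tiles and the order of their attachment agree
  let F : Finset (ℤ × ℤ) :=
    (finite_blockIndex_eq hc 0).toFinset ∪ (finite_blockIndex_eq hc d.vec).toFinset
  let movie : ℕ → (F → Option 𝒯.tiles) × (F → F → Prop) := fun s =>
    (fun x => β (x + (c : ℤ) • b s),
      fun x y => t (x + (c : ℤ) • b s) < t (y + (c : ℤ) • b s))
  obtain ⟨s, s', hs, hs', hlt, hmovie⟩ :
      ∃ s s', N ≤ s ∧ N ≤ s' ∧ s < s' ∧ movie s = movie s' := by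
    obtain ⟨i, j, hne, h⟩ := Finite.exists_ne_map_eq_of_infinite fun i => movie (N + i)
    rcases hne.lt_or_gt with h' | h'
    · exact ⟨N + i, N + j, by omega, by omega, by omega, h⟩
    · exact ⟨N + j, N + i, by omega, by omega, by omega, h.symm⟩
  let B : Finset (ℤ × ℤ) :=
    (finite_blockIndex_eq hc (b s)).toFinset ∪ (finite_blockIndex_eq hc (d.move (b s))).toFinset
  have memB : ∀ x, x ∈ B ↔ blockIndex c x = b s ∨ blockIndex c x = d.move (b s) := fun x => by
    simp [B]
  have hBF : ∀ x ∈ B, ∃ y : F, x = y + (c : ℤ) • b s := fun x hx => by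
    refine ⟨⟨x + (c : ℤ) • (-b s), ?_⟩, by simp⟩
    simp only [F, Finset.mem_union, Set.Finite.mem_toFinset, Set.mem_ofPred_eq,
      blockIndex_add_smul hc', ← sub_eq_add_neg]
    exact ((memB x).1 hx).imp (fun h => by simp [h])
      fun h => by rw [h, Dir.move_eq_add_vec, add_sub_cancel_left]
  have hshift : ∀ x, blockIndex c (x + (c : ℤ) • (b s' - b s)) =
      blockIndex c x + (b s' - b s) := fun x => blockIndex_add_smul hc' _ _
  have hadd : ∀ y : ℤ × ℤ, y + (c : ℤ) • b s + (c : ℤ) • (b s' - b s) = y + (c : ℤ) • b s' :=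
    fun y => by rw [add_assoc, ← smul_add, add_sub_cancel]
  have hleave : ∀ s x, ∀ d' : Dir, x ∈ W s → d'.move x ∈ scaling c P → d'.move x ∉ W s →
      d' = d ∧ blockIndex c (d.move x) = d.move (blockIndex c x) ∧
        blockIndex ((g : ℤ) ^ s) (d.move (blockIndex c x)) = d.move q := fun s x d' h1 h2 h3 =>
    eq_of_leaves_block (hk s) hc' (fun p => hP.blockIndex_pow_mem hG.pos s) hu h1 h2 h3
  have hcross : ∀ s x, ∀ d' : Dir, x ∈ W s → x ∈ scaling c P → d'.move x ∈ scaling c P →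
      d'.move x ∉ W s → blockIndex c x = b s ∧ blockIndex c (d'.move x) = d.move (b s) := by
    intro s x d' h1 h2 h3 h4
    obtain ⟨rfl, h5, h6⟩ := hleave s x d' h1 h3 h4
    have h3' : blockIndex c (d'.move x) ∈ P := h3
    rw [h5] at h3' ⊢
    have h7 := hbu s (blockIndex c x) ⟨h2, h3', h1, h6⟩
    exact ⟨h7, by rw [h7]⟩
  have hcoord : ∀ s, d.coord (b s) = (g : ℤ) ^ s * d.coord q + d.face ((g : ℤ) ^ s) := fun s => by
    obtain ⟨-, -, h1, h2⟩ := hb s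
    rw [← h1] at h2
    rw [← h1]
    exact (blockIndex_move_eq_iff (hk s) d (b s)).1 h2
  refine TAS.false_of_windows (fun γ => hX.dom_subset) hβX hβ.isSub ht ht0 htfin
    (W := W s) (W' := W s') (hN s hs) (hN s' hs') (v := (c : ℤ) • (b s' - b s)) (B := B)
    ?_ ?_ ?_ ?_ ?_ ?_ ?_
  · intro x h1 h2 d' h3 h4
    obtain ⟨h5, h6⟩ := hcross s x d' h1 h2 h3 h4
    exact ⟨(memB _).2 (.inl h5), (memB _).2 (.inr h6)⟩
  · intro x h1 h2 d' h3 h4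
    obtain ⟨h5, h6⟩ := hcross s' _ d' h1 h2 h3 h4
    rw [Dir.move_add] at h6
    rw [hshift] at h5 h6
    refine ⟨(memB _).2 (.inl ?_), (memB _).2 (.inr ?_)⟩
    · rw [eq_sub_of_add_eq h5]; abel
    · rw [eq_sub_of_add_eq h6, Dir.move_eq_add_vec, Dir.move_eq_add_vec]; abel
  · intro x hx
    have key : blockIndex ((g : ℤ) ^ s) (blockIndex c x) = q ↔
      blockIndex ((g : ℤ) ^ s') (blockIndex c x + (b s' - b s)) = q := by
      rcases (memB x).1 hx with h | h
      · rw [h, add_sub_cancel, (hb s).2.2.1, (hb s').2.2.1]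
      · have : d.move (b s) + (b s' - b s) = d.move (b s') := by
          rw [Dir.move_eq_add_vec, Dir.move_eq_add_vec]; abel
        rw [h, this, (hb s).2.2.2, (hb s').2.2.2]
    simpa only [W, Set.mem_ofPred_eq, hshift] using key
  · intro x hx
    obtain ⟨y, rfl⟩ := hBF x hx
    rw [hadd]
    exact (congrFun (congrArg Prod.fst hmovie) y).symm
  · intro x hx x' hx'
    obtain ⟨y, rfl⟩ := hBF x hx
    obtain ⟨y', rfl⟩ := hBF x' hx'
    rw [hadd, hadd]
    exact (congrFun (congrFun (congrArg Prod.snd hmovie) y) y').to_iff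
  · -- the larger block is too wide for the smaller one
    by_contra! hall
    have hcol : ∀ x : ℤ, x / (g : ℤ) ^ s' = q.1 → (x - (b s' - b s).1) / (g : ℤ) ^ s = q.1 := by
      intro x hx
      obtain ⟨y, hy, hy'⟩ := hP.exists_mem_column hG.pos hGs hG.column s' hq hx
      have hbi : ∀ u : ℤ × ℤ, blockIndex c ((c : ℤ) • u) = u := fun u => by
        ext <;> simp [blockIndex, hc.ne']
      have hz : (c : ℤ) • ((x, y) - (b s' - b s)) + (c : ℤ) • (b s' - b s) =
          (c : ℤ) • ((x, y) : ℤ × ℤ) := by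
        rw [← smul_add, sub_add_cancel]
      have := hall ((c : ℤ) • ((x, y) - (b s' - b s)))
        (by rw [hz]; simpa only [W, Set.mem_ofPred_eq, hbi] using hy')
        (by rw [hz]; simpa only [scaling, Set.mem_ofPred_eq] using
          (by rw [← blockIndex, hbi]; exact hy))
      simp only [W, Set.mem_ofPred_eq, hbi] at this
      exact congrArg Prod.fst this
    have hpow : (g : ℤ) ^ s < (g : ℤ) ^ s' :=
      pow_lt_pow_right₀ (by exact_mod_cast hG.one_lt) hlt
    have h1 := hcol ((g : ℤ) ^ s' * q.1) (by rw [Int.mul_ediv_cancel_left _ (hk s').ne'])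
    have h2 := hcol ((g : ℤ) ^ s' * q.1 + ((g : ℤ) ^ s' - 1)) (by
      rw [add_comm, Int.add_mul_ediv_left _ _ (hk s').ne',
        Int.ediv_eq_zero_of_lt (by linarith [hk s']) (by linarith), zero_add])
    have h3 : ((g : ℤ) ^ s' * q.1 - (b s' - b s).1 + (g : ℤ) ^ s) / (g : ℤ) ^ s ≤
        ((g : ℤ) ^ s' * q.1 + ((g : ℤ) ^ s' - 1) - (b s' - b s).1) / (g : ℤ) ^ s :=
      Int.ediv_le_ediv (hk s) (by linarith)
    rw [Int.add_ediv_of_dvd_right dvd_rfl, Int.ediv_self (hk s).ne', h1, h2] at h3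
    omega
  · intro x h1 h2 h3 d' h4 h5 h6
    obtain ⟨rfl, h7, h8⟩ := hleave s x d' h1 h6 h5
    have h1' : blockIndex ((g : ℤ) ^ s) (blockIndex c x) = q := h1
    have h2' : blockIndex ((g : ℤ) ^ s') (blockIndex c x + (b s' - b s)) = q := hshift x ▸ h2
    have h9 := (blockIndex_move_eq_iff (hk s) d' (blockIndex c x)).1 (by rw [h8, h1'])
    have h10 : d'.coord (blockIndex c x + (b s' - b s)) = d'.coord (b s') := by
      have h11 := d'.coord_add (b s) (b s' - b s)
      rw [add_sub_cancel, hcoord s] at h11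
      rw [h1'] at h9
      rw [Dir.coord_add, h9, h11]
    rw [hcoord s', ← h2'] at h10
    have h12 := (blockIndex_move_eq_iff (hk s') d' _).2 h10
    have h13 : blockIndex ((g : ℤ) ^ s') (blockIndex c (d'.move x) + (b s' - b s)) = q := by
      rw [← hshift, ← Dir.move_add]; exact h4
    rw [h7, ← Dir.move_add, h12, h2'] at h13
    exact d'.move_ne q h13

theorem theorem3 {Sym : Type*} (P : Set (ℤ × ℤ)) (hP : IsPierFractal P) (c : ℕ) (hc : 0 < c) :
    ¬ ∃ 𝒯 : TAS Sym, 𝒯.StrictlySelfAssembles (scaling c P) := by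
  obtain ⟨g, G, hG, rfl, -, hh, hv, p, hp⟩ := hP
  rintro ⟨𝒯, h𝒯⟩
  exact hG.not_strictlySelfAssembles (hG.existsUnique_isBridgeEnd hh hv) hp hc 𝒯 h𝒯
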